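/- Let $\mathbb{H}=\{x+iy: y>0\}$ be the hyperbolic plane and let $\mathcal F=\{z\in\mathbb H: |z|\ge 1,\ |\mathrm{Re}\,z|\le \tfrac12\}$ be the standard fundamental domain of $PSL(2,\mathbb Z)$, with finite vertices $\pm\tfrac12+\tfrac{\sqrt3}{2}i$, elliptic vertex $i$ and cusp $\infty$. Label, on the inside of $\mathcal F$, the side $\mathrm{Re}\,z=-\tfrac12$ by $R$, the side $\mathrm{Re}\,z=\tfrac12$ by $L$, and the side $|z|=1$ by $J$, and label the sides of each translate $h\mathcal F$, $h\in PSL(2,\mathbb Z)$, correspondingly. (The labels stand for the side-pairing elements $R:z\mapsto z+1$, $L:z\mapsto z-1$, $J:z\mapsto -1/z$.) An oriented geodesic $\gamma=\langle\theta_1,\theta_2\rangle$, with distinct $\theta_1,\theta_2\in\mathbb R\cup\{\infty\}$, travels from $\theta_1$ to $\theta_2$. It is in general position if it meets the interior of $\mathcal F$, contains no vertex and no segment of positive length of a side of any translate of $\mathcal F$ (the elliptic vertex $i$ counting as a vertex), and neither endpoint is a $PSL(2,\mathbb Z)$-translate of $\infty$. Such a $\gamma$ visits in order a sequence of translates $(h_i\mathcal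 F)_{i\in\mathbb Z}$ with $h_0=1$; its cutting sequence is $C(\gamma)=(g_i)_{i\in\mathbb Z}\in\{L,R,J\}^{\mathbb Z}$, where $g_i$ is the inside label of the side of $h_i\mathcal F$ through which $\gamma$ enters $h_i\mathcal F$. The cutting sequence shift $\Sigma_{\mathcal F}$ is the closure, in the product topology on $\{L,R,J\}^{\mathbb Z}$, of the set of all $C(\gamma)$ with $\gamma$ in general position. A shift of finite type over a finite alphabet $A$ is the set of all sequences in $A^{\mathbb Z}$ that avoid a given finite set of forbidden words, and a sofic shift is the image of a shift of finite type under a sliding block code. **Theorem 7.3.** The cutting sequence shift $\Sigma_{\mathcal F}$ is not a sofic shift. -/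

import Mathlib

open scoped UpperHalfPlane MatrixGroups Pointwise

/-! ## Symbolic dynamics: shifts of finite type, factors, sofic shifts -/

namespace SymbolicDynamics

/-- The finite word `w` occurs as a block of the bi-infinite sequence `x`. -/
def Occurs {A : Type*} (w : List A) (x : ℤ → A) : Prop :=
  ∃ i : ℤ, ∀ (k : ℕ) (hk : k < w.length), x (i + k) = w[k]

/-- `X` is a shift of finite type over the alphabet `A`: it consists of all bi-infinite sequences
that avoid some finite set of forbidden words. -/
def IsShiftOfFiniteType {A : Type*} (X : Set (ℤ → A)) : Prop :=
  ∃ W : Set (List A), W.Finite ∧ X = {x | ∀ w ∈ W, ¬ Occurs w x}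

/-- The sliding block code with memory `m` and anticipation `n` induced by the block map `Φ`:
the `i`-th symbol of the image of `x` is `Φ (x (i - m), …, x i, …, x (i + n))`. -/
def slidingBlockCode {A B : Type*} (m n : ℕ) (Φ : (Fin (m + n + 1) → A) → B) (x : ℤ → A) :
    ℤ → B :=
  fun i => Φ (fun k => x (i - m + (k : ℕ)))

/-- `Y` is a factor of `X`: it is the image of `X` under a sliding block code. -/
def IsFactor {A B : Type*} (X : Set (ℤ → A)) (Y : Set (ℤ → B)) : Prop :=
  ∃ (m n : ℕ) (Φ : (Fin (m + n + 1) → A) → B), slidingBlockCode m n Φ '' X = Y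

/-- A sofic shift is a factor of a shift of finite type (over some finite alphabet). -/
def IsSofic {B : Type*} (Y : Set (ℤ → B)) : Prop :=
  ∃ (A : Type) (_ : Finite A) (X : Set (ℤ → A)), IsShiftOfFiniteType X ∧ IsFactor X Y

end SymbolicDynamics

/-! ## Oriented geodesics of the upper half-plane -/

/-- An oriented geodesic `⟨θ₁, θ₂⟩` of the hyperbolic plane, given by its two distinct ideal
endpoints in `ℝ ∪ {∞}`; it is oriented from the head `θ₁` to the foot `θ₂`. -/
structure OrientedGeodesic where
  head : OnePoint ℝ
  foot : OnePoint ℝ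
  head_ne_foot : head ≠ foot

namespace OrientedGeodesic

/-- Real part at time `t` of the unit-speed parametrization of the geodesic from `θ₁` to `θ₂`.
(The last case is the excluded one.) -/
noncomputable def pathRe : OnePoint ℝ → OnePoint ℝ → ℝ → ℝ
  | OnePoint.some a, OnePoint.some b, t =>
      (a + b * Real.exp (2 * t)) / (1 + Real.exp (2 * t))
  | OnePoint.infty, OnePoint.some b, _ => b
  | OnePoint.some a, OnePoint.infty, _ => a
  | OnePoint.infty, OnePoint.infty, _ => 0

/-- Imaginary part at time `t` of the unit-speed parametrization of the geodesic from `θ₁` to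
`θ₂`. (The last case is the excluded one.) -/
noncomputable def pathIm : OnePoint ℝ → OnePoint ℝ → ℝ → ℝ
  | OnePoint.some a, OnePoint.some b, t =>
      |b - a| * Real.exp t / (1 + Real.exp (2 * t))
  | OnePoint.infty, OnePoint.some _, t => Real.exp (-t)
  | OnePoint.some _, OnePoint.infty, t => Real.exp t
  | OnePoint.infty, OnePoint.infty, _ => 1

theorem pathIm_pos {θ₁ θ₂ : OnePoint ℝ} (h : θ₁ ≠ θ₂) (t : ℝ) : 0 < pathIm θ₁ θ₂ t := by
  induction θ₁ using OnePoint.rec with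
  | infty =>
    induction θ₂ using OnePoint.rec with
    | infty => exact absurd rfl h
    | coe b => exact Real.exp_pos _
  | coe a =>
    induction θ₂ using OnePoint.rec with
    | infty => exact Real.exp_pos _
    | coe b =>
      have hab : b - a ≠ 0 := fun h0 => h (by rw [sub_eq_zero.mp h0])
      have := abs_pos.mpr hab
      change 0 < |b - a| * Real.exp t / (1 + Real.exp (2 * t))
      positivity

/-- The point reached at time `t` when the oriented geodesic is traversed at unit hyperbolic
speed from its head (`t → -∞`) to its foot (`t → ∞`): a half-circle perpendicular to the real
axis, or a vertical line if one of the endpoints is `∞`. -/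
noncomputable def point (γ : OrientedGeodesic) (t : ℝ) : ℍ :=
  ⟨⟨pathRe γ.head γ.foot t, pathIm γ.head γ.foot t⟩, pathIm_pos γ.head_ne_foot t⟩

end OrientedGeodesic

/-! ## Cutting sequences for the standard fundamental domain of the modular group

The standard fundamental domain `{z : |z| ≥ 1, |Re z| ≤ 1/2}` is Mathlib's `ModularGroup.fd`, and
its interior `{z : |z| > 1, |Re z| < 1/2}` is `ModularGroup.fdo`. `PSL(2,ℤ)` acts on `ℍ` through
`SL(2,ℤ)`, so its translates of the domain are the sets `h • ModularGroup.fd` with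
`h : SL(2, ℤ)`. -/

namespace ModularCutting

/-- The three symbols, standing for the three side-pairing elements of `PSL(2,ℤ)`:
`L` for `z ↦ z - 1`, `R` for `z ↦ z + 1` and `J` for `z ↦ -1/z`. -/
inductive Letter
  | L
  | R
  | J
  deriving DecidableEq

/-- The alphabet is discrete; `ℤ → Letter` then carries the product topology, which is the
symbol topology. -/
instance : TopologicalSpace Letter := ⊥

instance : DiscreteTopology Letter := ⟨rfl⟩

/-- The (open) side of the fundamental domain that carries a given label on its inside edge.
The side-pairing element named by the label maps this side to its paired side. -/
noncomputable def side : Letter → Set ℍ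
  | Letter.R => {z | z.re = -(1 / 2) ∧ Real.sqrt 3 / 2 < z.im}
  | Letter.L => {z | z.re = 1 / 2 ∧ Real.sqrt 3 / 2 < z.im}
  | Letter.J => {z | ‖(z : ℂ)‖ = 1 ∧ |z.re| < 1 / 2}

/-- The finite vertices of the fundamental domain: the two corners `± 1/2 + (√3/2) i` and the
elliptic vertex `i`. -/
noncomputable def finiteVertices : Set ℍ :=
  {z | z.re = -(1 / 2) ∧ z.im = Real.sqrt 3 / 2} ∪
  {z | z.re = 1 / 2 ∧ z.im = Real.sqrt 3 / 2} ∪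
  {UpperHalfPlane.I}

/-- General position geodesics: those that meet the interior of the fundamental domain, contain
no vertex and no segment of positive length of a side of any translate of it, and neither of
whose endpoints is a translate of the cusp `∞`. -/
structure IsGeneralPosition (γ : OrientedGeodesic) : Prop where
  meets_interior : ∃ t : ℝ, γ.point t ∈ ModularGroup.fdo
  avoids_vertices : ∀ (g : SL(2, ℤ)) (t : ℝ), γ.point t ∉ g • finiteVertices
  no_side_segment : ∀ (g : SL(2, ℤ)) (a : Letter),
    ¬ ∃ t₁ t₂ : ℝ, t₁ < t₂ ∧ ∀ t ∈ Set.Icc t₁ t₂, γ.point t ∈ g • side a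
  head_not_cusp : ∀ g : SL(2, ℤ),
    γ.head ≠ Matrix.SpecialLinearGroup.mapGL ℝ g • (OnePoint.infty : OnePoint ℝ)
  foot_not_cusp : ∀ g : SL(2, ℤ),
    γ.foot ≠ Matrix.SpecialLinearGroup.mapGL ℝ g • (OnePoint.infty : OnePoint ℝ)

/-- `c` is the cutting sequence of `γ`: the geodesic visits in order the translates `h i • F`,
`i ∈ ℤ`, with `h 0` the identity; it is in the interior of `h i • F` during the time interval
`(τ i, τ (i + 1))` (these intervals exhaust the whole geodesic, up to the crossing times `τ i`),
and at time `τ i` it enters `h i • F` through the side of `h i • F` whose inside label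
is `c i`. -/
def IsCuttingSequence (γ : OrientedGeodesic) (c : ℤ → Letter) : Prop :=
  ∃ (h : ℤ → SL(2, ℤ)) (τ : ℤ → ℝ),
    h 0 = 1 ∧ StrictMono τ ∧
    Filter.Tendsto τ Filter.atTop Filter.atTop ∧ Filter.Tendsto τ Filter.atBot Filter.atBot ∧
    (∀ i : ℤ, ∀ t ∈ Set.Ioo (τ i) (τ (i + 1)), γ.point t ∈ h i • ModularGroup.fdo) ∧
    (∀ i : ℤ, γ.point (τ i) ∈ h i • side (c i))

/-- The set of all cutting sequences of general position geodesics. -/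
def cuttingSequences : Set (ℤ → Letter) :=
  {c | ∃ γ : OrientedGeodesic, IsGeneralPosition γ ∧ IsCuttingSequence γ c}

/-- The two-sided cutting sequence shift: the closure, in the symbol topology, of the set of
cutting sequences of general position geodesics. -/
def cuttingSequenceShift : Set (ℤ → Letter) :=
  closure cuttingSequences

end ModularCutting

/-! Consider the blocks `J R^m J L J R J L^n J`. Seen from the tile entered through the central `J`,
a geodesic with such a block has head `-x/(x+1)` and foot `(y+1)/y`, where the lengths of the two
excursions give `|x - m| < 1` and `|y - n| < 1`. It runs close to the unit circle, which carries the
side `J`, and crosses it at real part `(y-x)/(x+y+1)`. The crossing lies on the side only if `2|y-x|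
< x+y+1`, which forces `n < 3m + 5` (`lt_of_mem_cuttingSequences`). On the other hand the block with
`m = n` occurs for every `m ≥ 10` (`exists_mem_cuttingSequences`). Thus the past of length `m` has
to be remembered across the central letters with unbounded precision.

A sofic shift has only finite memory: among infinitely many of its points, two can be spliced at a
given position (`IsSofic.exists_splice`). Taking `m = 10 * 4 ^ k` and splicing between the first
excursion and the middle yields a block with `n ≥ 4m`, a contradiction.

The link with geometry is the itinerary of endpoints: `Entry` expresses the letter at a tile by
inequalities between the endpoints seen from it, and `exists_tiles` provides cutting sequences for
generic endpoints. -/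

namespace ModularCutting

/-! ### Geodesics with real endpoints and the Möbius action -/

/-- The geodesic with real endpoints `a ≠ b`, parametrized by arc length. -/
noncomputable def arc {a b : ℝ} (h : a ≠ b) (t : ℝ) : ℍ :=
  OrientedGeodesic.point ⟨(a : OnePoint ℝ), (b : OnePoint ℝ), fun H => h (OnePoint.coe_injective H)⟩ t

theorem arc_re {a b : ℝ} (h : a ≠ b) (t : ℝ) :
    (arc h t).re = (a + b * Real.exp (2 * t)) / (1 + Real.exp (2 * t)) := rfl

theorem arc_im {a b : ℝ} (h : a ≠ b) (t : ℝ) :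
    (arc h t).im = |b - a| * Real.exp t / (1 + Real.exp (2 * t)) := rfl

theorem normSq_eq (z : ℍ) : Complex.normSq (z : ℂ) = z.re ^ 2 + z.im ^ 2 := by
  rw [Complex.normSq_apply]
  change z.re * z.re + z.im * z.im = _
  ring

/-- The pair `(Re z, |z|²)` determines `z`, and along a geodesic it is the average of `(a, a²)` and
`(b, b²)` with weights `1` and `e^{2t}`. In these coordinates geodesics are straight segments, sides
lie on lines and Möbius maps are projective, so all later crossing arguments are linear. -/
theorem arc_normSq {a b : ℝ} (h : a ≠ b) (t : ℝ) :
    Complex.normSq (arc h t : ℂ)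
      = (a ^ 2 + b ^ 2 * Real.exp (2 * t)) / (1 + Real.exp (2 * t)) := by
  rw [normSq_eq, arc_re, arc_im]
  have hs : Real.exp (2 * t) = Real.exp t ^ 2 := by
    rw [← Real.exp_nat_mul]; norm_num
  have h1 : (1 + Real.exp (2 * t)) ≠ 0 := by positivity
  rw [div_pow, div_pow, mul_pow, sq_abs, ← hs]
  field_simp
  ring

theorem ext_re_normSq {z w : ℍ} (h1 : z.re = w.re)
    (h2 : Complex.normSq (z : ℂ) = Complex.normSq (w : ℂ)) : z = w := by
  refine UpperHalfPlane.ext_re_im h1 ?_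
  rw [normSq_eq, normSq_eq, h1] at h2
  have := z.im_pos
  have := w.im_pos
  nlinarith

theorem continuous_arc {a b : ℝ} (h : a ≠ b) : Continuous (arc h) := by
  rw [UpperHalfPlane.isEmbedding_coe.continuous_iff]
  have : (UpperHalfPlane.coe ∘ arc h) = fun t : ℝ =>
      (((a + b * Real.exp (2 * t)) / (1 + Real.exp (2 * t)) : ℝ) : ℂ)
        + ((|b - a| * Real.exp t / (1 + Real.exp (2 * t)) : ℝ) : ℂ) * Complex.I := by
    funext t
    exact (Complex.re_add_im _).symm
  rw [this]
  have h1 : ∀ t : ℝ, (1 + Real.exp (2 * t)) ≠ 0 := fun t => by positivity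
  refine Continuous.add (Complex.continuous_ofReal.comp ?_)
    (Continuous.mul (Complex.continuous_ofReal.comp ?_) continuous_const)
  · exact Continuous.div (by fun_prop) (by fun_prop) h1
  · exact Continuous.div (by fun_prop) (by fun_prop) h1

/-- The action of `SL(2, ℤ)` on the real line by Möbius transformations (with junk value `0` at
the pole). -/
noncomputable def mob (g : SL(2, ℤ)) (x : ℝ) : ℝ := (g 0 0 * x + g 0 1) / (g 1 0 * x + g 1 1)

theorem det_eq_one (g : SL(2, ℤ)) : (g 0 0 : ℝ) * g 1 1 - g 0 1 * g 1 0 = 1 := by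
  have := g.det_coe
  rw [Matrix.det_fin_two] at this
  exact_mod_cast this

theorem denom_ne_zero {x : ℝ} (hx : Irrational x) (g : SL(2, ℤ)) :
    (g 1 0 * x + g 1 1 : ℝ) ≠ 0 := by
  intro h
  by_cases hc : g 1 0 = 0
  · have hd : (g 1 1 : ℝ) = 0 := by simpa [hc] using h
    have := det_eq_one g
    simp [hc, hd] at this
  · exact ((hx.intCast_mul hc).add_intCast (g 1 1)).ne_zero h

theorem irrational_mob {x : ℝ} (hx : Irrational x) (g : SL(2, ℤ)) : Irrational (mob g x) := by
  have hd := denom_ne_zero hx g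
  rintro ⟨q, hq⟩
  have h1 : (q : ℝ) * (g 1 0 * x + g 1 1) = g 0 0 * x + g 0 1 := by
    rw [hq, mob, div_mul_cancel₀ _ hd]
  have h2 : ((q * g 1 0 - g 0 0 : ℚ) : ℝ) * x = ((g 0 1 - q * g 1 1 : ℚ) : ℝ) := by
    push_cast; linarith
  have hdet := det_eq_one g
  by_cases h0 : (q * g 1 0 - g 0 0 : ℚ) = 0
  · rw [h0] at h2
    have h3 : (g 0 1 : ℝ) = q * g 1 1 := by
      push_cast at h2; linarith
    have h4 : (g 0 0 : ℝ) = q * g 1 0 := by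
      have : ((q * g 1 0 - g 0 0 : ℚ) : ℝ) = 0 := by rw [h0]; simp
      push_cast at this; linarith
    rw [h3, h4] at hdet
    ring_nf at hdet
    exact zero_ne_one hdet
  · exact (hx.ratCast_mul h0) ⟨_, h2.symm⟩

theorem mob_one (x : ℝ) : mob 1 x = x := by simp [mob]

theorem mob_neg (g : SL(2, ℤ)) (x : ℝ) : mob (-g) x = mob g x := by
  simp only [mob, Matrix.SpecialLinearGroup.coe_neg, Matrix.neg_apply, Int.cast_neg]
  rw [← neg_div_neg_eq]
  congr 1 <;> ring

theorem mob_mul (g k : SL(2, ℤ)) {x : ℝ} (hx : Irrational x) :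
    mob (g * k) x = mob g (mob k x) := by
  have h1 := denom_ne_zero hx k
  have h2 := denom_ne_zero (irrational_mob hx k) g
  have h3 := denom_ne_zero hx (g * k)
  simp only [mob, Matrix.SpecialLinearGroup.coe_mul, Matrix.mul_apply, Fin.sum_univ_two,
    Int.cast_add, Int.cast_mul] at *
  rw [div_eq_div_iff h3 h2]
  field_simp
  ring

theorem mob_ne {a b : ℝ} (ha : Irrational a) (hb : Irrational b) (h : a ≠ b) (g : SL(2, ℤ)) :
    mob g a ≠ mob g b := by
  intro H
  apply h
  rw [← mob_one a, ← mob_one b, ← inv_mul_cancel g, mob_mul _ _ ha, mob_mul _ _ hb, H]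

theorem normSq_denom (g : SL(2, ℤ)) (z : ℍ) :
    Complex.normSq ((g 1 0 : ℂ) * z + g 1 1)
      = (g 1 0 : ℝ) ^ 2 * Complex.normSq z + 2 * g 1 0 * g 1 1 * z.re + (g 1 1 : ℝ) ^ 2 := by
  rw [Complex.normSq_apply, Complex.normSq_apply]
  simp
  ring

theorem normSq_denom_pos (g : SL(2, ℤ)) (z : ℍ) :
    0 < (g 1 0 : ℝ) ^ 2 * Complex.normSq z + 2 * g 1 0 * g 1 1 * z.re + (g 1 1 : ℝ) ^ 2 := by
  rw [← normSq_denom]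
  exact UpperHalfPlane.normSq_denom_pos (g : GL (Fin 2) ℝ) z.im_ne_zero

theorem coe_smul_eq (g : SL(2, ℤ)) (z : ℍ) :
    ((g • z : ℍ) : ℂ) = ((g 0 0 : ℂ) * z + g 0 1) / ((g 1 0 : ℂ) * z + g 1 1) := by
  rw [UpperHalfPlane.coe_specialLinearGroup_apply]
  simp

theorem normSq_smul (g : SL(2, ℤ)) (z : ℍ) :
    Complex.normSq ((g • z : ℍ) : ℂ)
      = ((g 0 0 : ℝ) ^ 2 * Complex.normSq z + 2 * g 0 0 * g 0 1 * z.re + (g 0 1 : ℝ) ^ 2) /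
        ((g 1 0 : ℝ) ^ 2 * Complex.normSq z + 2 * g 1 0 * g 1 1 * z.re + (g 1 1 : ℝ) ^ 2) := by
  rw [coe_smul_eq, Complex.normSq_div, normSq_denom]
  congr 1
  rw [Complex.normSq_apply, Complex.normSq_apply]
  simp
  ring

theorem re_smul (g : SL(2, ℤ)) (z : ℍ) :
    (g • z : ℍ).re
      = ((g 0 0 : ℝ) * g 1 0 * Complex.normSq z + (g 0 0 * g 1 1 + g 0 1 * g 1 0) * z.re
          + g 0 1 * g 1 1) /
        ((g 1 0 : ℝ) ^ 2 * Complex.normSq z + 2 * g 1 0 * g 1 1 * z.re + (g 1 1 : ℝ) ^ 2) := by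
  have : (g • z : ℍ).re = ((g • z : ℍ) : ℂ).re := rfl
  rw [this, coe_smul_eq, Complex.div_re, ← add_div, normSq_denom]
  congr 1
  rw [Complex.normSq_apply]
  simp
  ring

/-- Applying `g` multiplies the weights of the two endpoints by `u²` and `v²`, the squared
denominators at `a` and `b`. Rescaling the weight of the head to `1` is a time shift by `log |v /
u|`. -/
theorem smul_arc {a b : ℝ} (ha : Irrational a) (hb : Irrational b) (h : a ≠ b) (g : SL(2, ℤ)) :
    ∃ κ : ℝ, ∀ t, g • arc h t = arc (mob_ne ha hb h g) (t + κ) := by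
  have h1 := denom_ne_zero ha g
  have h2 := denom_ne_zero hb g
  set u : ℝ := g 1 0 * a + g 1 1 with hu
  set v : ℝ := g 1 0 * b + g 1 1 with hv
  refine ⟨Real.log |v / u|, fun t => ?_⟩
  have hs : Real.exp (2 * (t + Real.log |v / u|)) = Real.exp (2 * t) * (v / u) ^ 2 := by
    rw [mul_add, Real.exp_add]
    congr 1
    rw [two_mul, Real.exp_add, Real.exp_log (by positivity), ← sq, sq_abs]
  set s := Real.exp (2 * t) with hs'
  have hs0 : 0 < s := Real.exp_pos _
  have e1 : 1 + s ≠ 0 := by positivity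
  have e3 : u ^ 2 + s * v ^ 2 ≠ 0 := by positivity
  have hD : (g 1 0 : ℝ) ^ 2 * ((a ^ 2 + b ^ 2 * s) / (1 + s))
      + 2 * g 1 0 * g 1 1 * ((a + b * s) / (1 + s)) + (g 1 1 : ℝ) ^ 2
      = (u ^ 2 + s * v ^ 2) / (1 + s) := by
    field_simp
    ring
  have hK : 1 + s * (v / u) ^ 2 = (u ^ 2 + s * v ^ 2) / u ^ 2 := by
    field_simp
  apply ext_re_normSq
  · rw [re_smul, arc_normSq, arc_re, arc_re, hs, ← hs', hD, hK]
    simp only [mob]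
    rw [← hu, ← hv]
    field_simp
    rw [hu, hv]
    ring
  · rw [normSq_smul, arc_normSq, arc_normSq, arc_re, hs, ← hs', hD, hK]
    simp only [mob]
    rw [← hu, ← hv]
    field_simp
    ring

/-! ### Walls: the sides as zero sets of affine functions -/

open Filter Topology

/-- The side-pairing element named by a letter. -/
def mat : Letter → SL(2, ℤ)
  | Letter.R => ModularGroup.T
  | Letter.L => ModularGroup.T⁻¹
  | Letter.J => ModularGroup.S

/-- The affine function of `(Re z, |z|²)` which vanishes on the side with a given label and is
positive inside the fundamental domain. -/
noncomputable def lin : Letter → ℝ → ℝ → ℝ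
  | Letter.R, x, _ => x + 1 / 2
  | Letter.L, x, _ => 1 / 2 - x
  | Letter.J, _, n => n - 1

/-- The value of `lin e` at a point of the hyperbolic plane. -/
noncomputable def wall (e : Letter) (z : ℍ) : ℝ := lin e z.re (Complex.normSq z)

/-- The geodesics carrying the sides have endpoints in `ℚ ∪ {∞}`, so an irrational endpoint lies
strictly on one side of each. -/
theorem lin_ne_zero (e : Letter) {a : ℝ} (ha : Irrational a) : lin e a (a ^ 2) ≠ 0 := by
  intro h
  cases e with
  | L => exact ha ⟨1 / 2, by simp only [lin] at h; push_cast; linarith⟩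
  | R => exact ha ⟨-(1 / 2), by simp only [lin] at h; push_cast; linarith⟩
  | J =>
    simp only [lin] at h
    have : (a - 1) * (a + 1) = 0 := by linarith
    rcases mul_eq_zero.mp this with h | h
    · exact ha ⟨1, by push_cast; linarith⟩
    · exact ha ⟨-1, by push_cast; linarith⟩

theorem wall_arc (e : Letter) {a b : ℝ} (h : a ≠ b) (t : ℝ) :
    wall e (arc h t) * (1 + Real.exp (2 * t))
      = lin e a (a ^ 2) + lin e b (b ^ 2) * Real.exp (2 * t) := by
  have h1 : (1 + Real.exp (2 * t)) ≠ 0 := by positivity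
  cases e <;> simp only [wall, lin, arc_re, arc_normSq] <;> field_simp <;> ring

theorem lin_head_of_wall_eq_zero {e : Letter} {a b : ℝ} {h : a ≠ b} {T : ℝ}
    (hT : wall e (arc h T) = 0) :
    lin e a (a ^ 2) = -(lin e b (b ^ 2) * Real.exp (2 * T)) := by
  have := wall_arc e h T
  rw [hT, zero_mul] at this
  linarith

theorem wall_arc_of_wall_eq_zero {e : Letter} {a b : ℝ} {h : a ≠ b} {T : ℝ}
    (hT : wall e (arc h T) = 0) (t : ℝ) :
    wall e (arc h t)
      = lin e b (b ^ 2) * ((Real.exp (2 * t) - Real.exp (2 * T)) / (1 + Real.exp (2 * t))) := by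
  have h1 : (1 + Real.exp (2 * t)) ≠ 0 := by positivity
  rw [mul_div_assoc', eq_div_iff h1, wall_arc, lin_head_of_wall_eq_zero hT]
  ring

theorem wall_factor_pos {T t : ℝ} (h : T < t) :
    0 < (Real.exp (2 * t) - Real.exp (2 * T)) / (1 + Real.exp (2 * t)) := by
  have : Real.exp (2 * T) < Real.exp (2 * t) := Real.exp_lt_exp.mpr (by linarith)
  exact div_pos (by linarith) (by positivity)

theorem wall_factor_neg {T t : ℝ} (h : t < T) :
    (Real.exp (2 * t) - Real.exp (2 * T)) / (1 + Real.exp (2 * t)) < 0 := by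
  have : Real.exp (2 * t) < Real.exp (2 * T) := Real.exp_lt_exp.mpr (by linarith)
  exact div_neg_of_neg_of_pos (by linarith) (by positivity)

theorem wall_arc_ne_zero {e : Letter} {a b : ℝ} {h : a ≠ b} (hb : Irrational b) {T t : ℝ}
    (hT : wall e (arc h T) = 0) (ht : t ≠ T) : wall e (arc h t) ≠ 0 := by
  rw [wall_arc_of_wall_eq_zero hT]
  refine mul_ne_zero (lin_ne_zero e hb) ?_
  rcases ht.lt_or_gt with h | h
  · exact (wall_factor_neg h).ne
  · exact (wall_factor_pos h).ne'

theorem wall_pos_of_mem_fdo {z : ℍ} (hz : z ∈ ModularGroup.fdo) (e : Letter) : 0 < wall e z := by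
  obtain ⟨h1, h2⟩ := hz
  rw [abs_lt] at h2
  cases e <;> simp only [wall, lin] <;> linarith

theorem normSq_of_norm_eq_one {z : ℍ} : ‖(z : ℂ)‖ = 1 ↔ Complex.normSq (z : ℂ) = 1 := by
  rw [Complex.normSq_eq_norm_sq, pow_eq_one_iff_of_nonneg (norm_nonneg _) two_ne_zero]

theorem wall_eq_zero_of_mem_side {z : ℍ} {e : Letter} (hz : z ∈ side e) : wall e z = 0 := by
  cases e with
  | L => simp only [wall, lin]; linarith [hz.1]
  | R => simp only [wall, lin]; linarith [hz.1]
  | J => simp only [wall, lin]; linarith [normSq_of_norm_eq_one.mp hz.1]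

theorem one_lt_normSq_of_im {z : ℍ} (h : Real.sqrt 3 / 2 < z.im) (hx : z.re ^ 2 = 1 / 4) :
    1 < Complex.normSq (z : ℂ) := by
  rw [normSq_eq]
  have h3 : Real.sqrt 3 ^ 2 = 3 := Real.sq_sqrt (by norm_num)
  have h4 := Real.sqrt_nonneg 3
  nlinarith

theorem mem_fd_cases {z : ℍ} (hz : z ∈ ModularGroup.fd) :
    z ∈ ModularGroup.fdo ∨ (∃ e, z ∈ side e) ∨ z ∈ finiteVertices := by
  obtain ⟨h1, h2⟩ := hz
  have h3 : Real.sqrt 3 ^ 2 = 3 := Real.sq_sqrt (by norm_num)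
  have h4 := Real.sqrt_nonneg 3
  have hy := z.im_pos
  rcases h2.lt_or_eq with h2 | h2
  · rcases h1.lt_or_eq with h1 | h1
    · exact Or.inl ⟨h1, h2⟩
    · exact Or.inr (Or.inl ⟨Letter.J, normSq_of_norm_eq_one.mpr h1.symm, h2⟩)
  · have hx : z.re ^ 2 = 1 / 4 := by rw [← sq_abs, h2]; norm_num
    have hle : Real.sqrt 3 / 2 ≤ z.im := by
      rw [normSq_eq, hx] at h1
      nlinarith
    rcases hle.lt_or_eq with hlt | heq
    · rcases eq_or_eq_neg_of_abs_eq h2 with h | h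
      · exact Or.inr (Or.inl ⟨Letter.L, h, hlt⟩)
      · exact Or.inr (Or.inl ⟨Letter.R, h, hlt⟩)
    · rcases eq_or_eq_neg_of_abs_eq h2 with h | h
      · exact Or.inr (Or.inr (Or.inl (Or.inr ⟨h, heq.symm⟩)))
      · exact Or.inr (Or.inr (Or.inl (Or.inl ⟨h, heq.symm⟩)))

theorem re_T_smul (z : ℍ) : (ModularGroup.T • z).re = z.re + 1 := by
  rw [re_smul]; simp [ModularGroup.coe_T]

theorem normSq_T_smul (z : ℍ) :
    Complex.normSq ((ModularGroup.T • z : ℍ) : ℂ) = Complex.normSq (z : ℂ) + 2 * z.re + 1 := by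
  rw [normSq_smul]; simp [ModularGroup.coe_T]

theorem re_T_inv_smul (z : ℍ) : (ModularGroup.T⁻¹ • z).re = z.re - 1 := by
  rw [re_smul]; simp [ModularGroup.coe_T]; ring

theorem normSq_T_inv_smul (z : ℍ) :
    Complex.normSq ((ModularGroup.T⁻¹ • z : ℍ) : ℂ) = Complex.normSq (z : ℂ) - 2 * z.re + 1 := by
  rw [normSq_smul]; simp [ModularGroup.coe_T]; ring

theorem re_S_smul (z : ℍ) : (ModularGroup.S • z).re = -z.re / Complex.normSq (z : ℂ) := by
  rw [re_smul]; simp [ModularGroup.coe_S]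

theorem normSq_S_smul (z : ℍ) :
    Complex.normSq ((ModularGroup.S • z : ℍ) : ℂ) = 1 / Complex.normSq (z : ℂ) := by
  rw [normSq_smul]; simp [ModularGroup.coe_S]

theorem normSq_pos (z : ℍ) : 0 < Complex.normSq (z : ℂ) := by
  rw [normSq_eq]
  have := z.im_pos
  positivity

theorem continuous_normSq : Continuous fun z : ℍ => Complex.normSq (z : ℂ) :=
  Complex.continuous_normSq.comp UpperHalfPlane.continuous_coe

/-- Near a point of an open side only the two adjacent tiles are present, and the sign of the wall
function tells them apart; `mat e` carries the outer one back to the fundamental domain. -/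
theorem eventually_of_mem_side {z : ℍ} {e : Letter} (hz : z ∈ side e) :
    ∀ᶠ w in 𝓝 z, (0 < wall e w → w ∈ ModularGroup.fdo) ∧
      (wall e w < 0 → mat e • w ∈ ModularGroup.fdo) := by
  have hre := UpperHalfPlane.continuous_re
  have hN := continuous_normSq
  cases e with
  | L =>
    obtain ⟨h1, h2⟩ := hz
    have hn := one_lt_normSq_of_im h2 (by rw [h1]; norm_num)
    have e1 : ∀ᶠ w : ℍ in 𝓝 z, 1 < Complex.normSq (w : ℂ) :=
      hN.continuousAt.eventually_const_lt hn
    have e2 : ∀ᶠ w : ℍ in 𝓝 z, 1 < Complex.normSq (w : ℂ) - 2 * w.re + 1 :=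
      (by fun_prop : Continuous fun w : ℍ => Complex.normSq (w : ℂ) - 2 * w.re + 1
        ).continuousAt.eventually_const_lt (by beta_reduce; rw [h1]; linarith)
    have e3 : ∀ᶠ w : ℍ in 𝓝 z, w.re < 3 / 2 :=
      hre.continuousAt.eventually_lt_const (by rw [h1]; norm_num)
    have e4 : ∀ᶠ w : ℍ in 𝓝 z, -(1 / 2) < w.re :=
      hre.continuousAt.eventually_const_lt (by rw [h1]; norm_num)
    filter_upwards [e1, e2, e3, e4] with w w1 w2 w3 w4
    simp only [wall, lin, mat]
    refine ⟨fun h => ⟨w1, abs_lt.mpr ⟨by linarith, by linarith⟩⟩, fun h => ⟨?_, ?_⟩⟩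
    · rw [normSq_T_inv_smul]; exact w2
    · rw [re_T_inv_smul]; exact abs_lt.mpr ⟨by linarith, by linarith⟩
  | R =>
    obtain ⟨h1, h2⟩ := hz
    have hn := one_lt_normSq_of_im h2 (by rw [h1]; norm_num)
    have e1 : ∀ᶠ w : ℍ in 𝓝 z, 1 < Complex.normSq (w : ℂ) :=
      hN.continuousAt.eventually_const_lt hn
    have e2 : ∀ᶠ w : ℍ in 𝓝 z, 1 < Complex.normSq (w : ℂ) + 2 * w.re + 1 :=
      (by fun_prop : Continuous fun w : ℍ => Complex.normSq (w : ℂ) + 2 * w.re + 1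
        ).continuousAt.eventually_const_lt (by beta_reduce; rw [h1]; linarith)
    have e3 : ∀ᶠ w : ℍ in 𝓝 z, w.re < 1 / 2 :=
      hre.continuousAt.eventually_lt_const (by rw [h1]; norm_num)
    have e4 : ∀ᶠ w : ℍ in 𝓝 z, -(3 / 2) < w.re :=
      hre.continuousAt.eventually_const_lt (by rw [h1]; norm_num)
    filter_upwards [e1, e2, e3, e4] with w w1 w2 w3 w4
    simp only [wall, lin, mat]
    refine ⟨fun h => ⟨w1, abs_lt.mpr ⟨by linarith, by linarith⟩⟩, fun h => ⟨?_, ?_⟩⟩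
    · rw [normSq_T_smul]; exact w2
    · rw [re_T_smul]; exact abs_lt.mpr ⟨by linarith, by linarith⟩
  | J =>
    obtain ⟨h1, h2⟩ := hz
    rw [normSq_of_norm_eq_one] at h1
    have e1 : ∀ᶠ w : ℍ in 𝓝 z, |w.re| < 1 / 2 :=
      (by fun_prop : Continuous fun w : ℍ => |w.re|).continuousAt.eventually_lt_const h2
    have e2 : ∀ᶠ w : ℍ in 𝓝 z, |-w.re / Complex.normSq (w : ℂ)| < 1 / 2 := by
      have hc : Continuous fun w : ℍ => |-w.re / Complex.normSq (w : ℂ)| :=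
        (hre.neg.div hN fun w => (normSq_pos w).ne').abs
      refine hc.continuousAt.eventually_lt_const ?_
      beta_reduce
      rw [h1, div_one, abs_neg]
      exact h2
    filter_upwards [e1, e2] with w w1 w2
    simp only [wall, lin, mat]
    refine ⟨fun h => ⟨by linarith, w1⟩, fun h => ⟨?_, ?_⟩⟩
    · rw [normSq_S_smul]
      exact (one_lt_div (normSq_pos w)).mpr (by linarith)
    · rw [re_S_smul]; exact w2

/-! ### Letters read off from the endpoints -/

theorem arc_circle {a b : ℝ} (h : a ≠ b) (t : ℝ) :
    Complex.normSq (arc h t : ℂ) = (a + b) * (arc h t).re - a * b := by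
  rw [arc_re, arc_normSq]
  have h1 : (1 + Real.exp (2 * t)) ≠ 0 := by positivity
  field_simp
  ring

/-- The conditions on the endpoints of a geodesic for it to enter the fundamental domain through
the side with a given label. -/
def Entry : Letter → ℝ → ℝ → Prop
  | Letter.R, a, b => a < -(1 / 2) ∧ -(1 / 2) < b ∧ 3 / 4 < (-(1 / 2) - a) * (b + 1 / 2)
  | Letter.L, a, b => b < 1 / 2 ∧ 1 / 2 < a ∧ 3 / 4 < (a - 1 / 2) * (1 / 2 - b)
  | Letter.J, a, b => a ^ 2 < 1 ∧ 1 < b ^ 2 ∧ 2 * |1 + a * b| < |a + b|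

/-- The action of the side-pairing elements on the real line. -/
noncomputable def act : Letter → ℝ → ℝ
  | Letter.R, x => x + 1
  | Letter.L, x => x - 1
  | Letter.J, x => -1 / x

theorem mob_mat (e : Letter) (x : ℝ) : mob (mat e) x = act e x := by
  cases e <;> simp [mob, mat, act, ModularGroup.coe_T, ModularGroup.coe_S, sub_eq_add_neg]

/-- The first two conditions say that the endpoints are separated by the wall. The third says that
the crossing avoids the corners: by `arc_circle` it has `|z|² > 1` on a vertical side, and real part
`(1 + ab)/(a + b)` on the circle. -/
theorem entry_of_mem_side {a b : ℝ} {h : a ≠ b} {T : ℝ} {e : Letter}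
    (hT : arc h T ∈ side e) (hb : 0 < lin e b (b ^ 2)) : Entry e a b := by
  have hw := wall_eq_zero_of_mem_side hT
  have ha : lin e a (a ^ 2) < 0 := by
    rw [lin_head_of_wall_eq_zero hw]
    have : 0 < lin e b (b ^ 2) * Real.exp (2 * T) := by positivity
    linarith
  have hc := arc_circle h T
  cases e with
  | L =>
    simp only [lin] at ha hb
    have hn := one_lt_normSq_of_im hT.2 (by rw [hT.1]; norm_num)
    rw [hc, hT.1] at hn
    exact ⟨by linarith, by linarith, by linarith⟩
  | R =>
    simp only [lin] at ha hb
    have hn := one_lt_normSq_of_im hT.2 (by rw [hT.1]; norm_num)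
    rw [hc, hT.1] at hn
    exact ⟨by linarith, by linarith, by linarith⟩
  | J =>
    simp only [lin] at ha hb
    have hn := normSq_of_norm_eq_one.mp hT.1
    rw [hc] at hn
    refine ⟨by linarith, by linarith, ?_⟩
    have hab : 0 < |a + b| := by
      rw [abs_pos]
      intro h0
      obtain rfl : a = -b := by linarith
      nlinarith
    have : 1 + a * b = (a + b) * (arc h T).re := by linarith
    rw [this, abs_mul]
    nlinarith [hT.2]

theorem eq_or_eq_neg_of_mem_fdo {g k : SL(2, ℤ)} {z : ℍ} (hg : z ∈ g • ModularGroup.fdo)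
    (hk : z ∈ k • ModularGroup.fd) : g = k ∨ g = -k := by
  rw [Set.mem_smul_set_iff_inv_smul_mem] at hg hk
  have h : (k⁻¹ * g) • (g⁻¹ • z) ∈ ModularGroup.fd := by
    rw [smul_smul, mul_assoc, mul_inv_cancel, mul_one]; exact hk
  rcases ModularGroup.eq_one_or_neg_one_of_mem_fdo_mem_fd hg h with h | h
  · exact Or.inl (inv_mul_eq_one.mp h).symm
  · right
    rw [inv_mul_eq_iff_eq_mul] at h
    simpa using h

theorem mob_eq_of_eq_or_neg {g k : SL(2, ℤ)} (h : g = k ∨ g = -k) (x : ℝ) :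
    mob g x = mob k x := by
  rcases h with rfl | rfl
  · rfl
  · exact mob_neg _ _

/-- The endpoints seen from the `i`-th tile are their images under `(h i)⁻¹`. The sign ambiguity of
`SL(2, ℤ)` over `PSL(2, ℤ)` disappears under `mob`. -/
theorem exists_itinerary {a b : ℝ} (ha : Irrational a) (hb : Irrational b) (hab : a ≠ b)
    {h : ℤ → SL(2, ℤ)} {τ : ℤ → ℝ} {c : ℤ → Letter} (h0 : h 0 = 1) (hτ : StrictMono τ)
    (htile : ∀ i : ℤ, ∀ t ∈ Set.Ioo (τ i) (τ (i + 1)), arc hab t ∈ h i • ModularGroup.fdo)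
    (hside : ∀ i : ℤ, arc hab (τ i) ∈ h i • side (c i)) :
    ∃ A B : ℤ → ℝ, A 0 = a ∧ B 0 = b ∧ ∀ i, Irrational (A i) ∧ Irrational (B i) ∧
      Entry (c i) (A i) (B i) ∧ A (i - 1) = act (c i) (A i) ∧ B (i - 1) = act (c i) (B i) := by
  refine ⟨fun i => mob (h i)⁻¹ a, fun i => mob (h i)⁻¹ b, by simp [h0, mob_one],
    by simp [h0, mob_one], fun i => ?_⟩
  have hA := irrational_mob ha (h i)⁻¹
  have hB := irrational_mob hb (h i)⁻¹
  obtain ⟨κ, hκ⟩ := smul_arc ha hb hab (h i)⁻¹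
  set hAB := mob_ne ha hb hab (h i)⁻¹
  have hs : arc hAB (τ i + κ) ∈ side (c i) := by
    rw [← hκ, ← Set.mem_smul_set_iff_inv_smul_mem]; exact hside i
  have hw := wall_eq_zero_of_mem_side hs
  have hpos : 0 < lin (c i) (mob (h i)⁻¹ b) (mob (h i)⁻¹ b ^ 2) := by
    obtain ⟨t, ht⟩ := exists_between (hτ (lt_add_one i))
    have h1 := htile i t ht
    rw [Set.mem_smul_set_iff_inv_smul_mem, hκ] at h1
    have h2 := wall_pos_of_mem_fdo h1 (c i)
    rw [wall_arc_of_wall_eq_zero hw] at h2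
    exact pos_of_mul_pos_left h2 (wall_factor_pos (by linarith [ht.1])).le
  -- Just before `τ i` the wall function is negative, so the geodesic is in the neighbour across the
  -- side `c i`; this identifies `h (i - 1)` up to sign.
  have hev : ∀ᶠ t in 𝓝[<] (τ i), arc hAB (t + κ) ∈ (mat (c i))⁻¹ • ModularGroup.fdo := by
    have hcont : Continuous fun t : ℝ => arc hAB (t + κ) :=
      (continuous_arc hAB).comp (by fun_prop)
    have h1 := (hcont.continuousAt (x := τ i)).eventually (eventually_of_mem_side hs)
    filter_upwards [nhdsWithin_le_nhds h1, self_mem_nhdsWithin] with t ht htlt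
    rw [Set.mem_smul_set_iff_inv_smul_mem, inv_inv]
    refine ht.2 ?_
    rw [wall_arc_of_wall_eq_zero hw]
    have htlt' : t < τ i := htlt
    exact mul_neg_of_pos_of_neg hpos (wall_factor_neg (by linarith))
  have hprev : ∀ᶠ t in 𝓝[<] (τ i), t ∈ Set.Ioo (τ (i - 1)) (τ i) :=
    Ioo_mem_nhdsLT (hτ (sub_one_lt i))
  obtain ⟨t, ht1, ht2⟩ := (hev.and hprev).exists
  have ht3 : arc hab t ∈ h (i - 1) • ModularGroup.fdo := by
    refine htile (i - 1) t ?_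
    rwa [sub_add_cancel]
  have ht4 : arc hab t ∈ (h i * (mat (c i))⁻¹) • ModularGroup.fd := by
    rw [← hκ] at ht1
    rw [mul_smul, Set.mem_smul_set_iff_inv_smul_mem]
    exact Set.smul_set_mono ModularGroup.fdo_subset_fd ht1
  have heq : (h (i - 1))⁻¹ = mat (c i) * (h i)⁻¹ ∨ (h (i - 1))⁻¹ = -(mat (c i) * (h i)⁻¹) := by
    rcases eq_or_eq_neg_of_mem_fdo ht3 ht4 with h | h
    · left; rw [h]; simp
    · right; rw [h, inv_eq_iff_mul_eq_one, neg_mul_neg]; group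
  refine ⟨hA, hB, entry_of_mem_side hs hpos, ?_, ?_⟩ <;> beta_reduce
  · rw [mob_eq_of_eq_or_neg heq, mob_mul _ _ ha, mob_mat]
  · rw [mob_eq_of_eq_or_neg heq, mob_mul _ _ hb, mob_mat]

/-! ### Existence of cutting sequences for irrational endpoints -/

/-- By Bézout, every reduced fraction is the first column of a matrix in `SL(2, ℤ)`, so every
rational is a translate of `∞`. -/
theorem exists_irrational_of_not_cusp {θ : OnePoint ℝ}
    (h : ∀ g : SL(2, ℤ), θ ≠ Matrix.SpecialLinearGroup.mapGL ℝ g • (OnePoint.infty : OnePoint ℝ)) :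
    ∃ a : ℝ, Irrational a ∧ θ = a := by
  induction θ using OnePoint.rec with
  | infty => exact absurd (by simp) (h 1)
  | coe a =>
    refine ⟨a, ?_, rfl⟩
    rintro ⟨q, rfl⟩
    have hcop : IsCoprime q.num (q.den : ℤ) := by
      rw [Int.isCoprime_iff_gcd_eq_one]
      exact q.reduced
    obtain ⟨u, v, huv⟩ := hcop
    obtain ⟨g, hg0, hg1⟩ : ∃ g : SL(2, ℤ), g 0 0 = q.num ∧ g 1 0 = q.den :=
      ⟨⟨!![q.num, -v; (q.den : ℤ), u], by rw [Matrix.det_fin_two_of]; linarith⟩, rfl, rfl⟩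
    refine h g ?_
    rw [OnePoint.smul_infty_eq_ite]
    simp [Rat.cast_def, hg0, hg1]

theorem ne_cusp_of_irrational {a : ℝ} (ha : Irrational a) (g : SL(2, ℤ)) :
    (a : OnePoint ℝ) ≠ Matrix.SpecialLinearGroup.mapGL ℝ g • (OnePoint.infty : OnePoint ℝ) := by
  rw [OnePoint.smul_infty_eq_ite]
  split_ifs with h
  · exact OnePoint.coe_ne_infty a
  · intro H
    refine ha ⟨(g 0 0 : ℚ) / g 1 0, ?_⟩
    have := OnePoint.coe_injective H
    rw [this]
    simp

/-- A subset of the line that is locally finite and unbounded in both directions is the range of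
a strictly increasing bi-infinite sequence. -/
theorem exists_strictMono_range_eq {D : Set ℝ} (hfin : ∀ x y, (D ∩ Set.Icc x y).Finite)
    (hup : ∀ x, ∃ d ∈ D, x < d) (hdown : ∀ x, ∃ d ∈ D, d < x) :
    ∃ τ : ℤ → ℝ, StrictMono τ ∧ Set.range τ = D := by
  classical
  have hf : ∀ x y : D, (Set.Icc x y).Finite := fun x y =>
    Set.Finite.of_finite_image
      ((hfin x y).subset (by rintro _ ⟨z, hz, rfl⟩; exact ⟨z.2, hz.1, hz.2⟩))
      Subtype.val_injective.injOn
  let _ : LocallyFiniteOrder D := LocallyFiniteOrder.ofFiniteIcc hf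
  let _ : SuccOrder D := LinearLocallyFiniteOrder.succOrder D
  let _ : PredOrder D := LinearLocallyFiniteOrder.predOrder D
  have : NoMaxOrder D := ⟨fun x => by
    obtain ⟨d, hd, h⟩ := hup x
    exact ⟨⟨d, hd⟩, h⟩⟩
  have : NoMinOrder D := ⟨fun x => by
    obtain ⟨d, hd, h⟩ := hdown x
    exact ⟨⟨d, hd⟩, h⟩⟩
  have : Nonempty D := by
    obtain ⟨d, hd, -⟩ := hup 0
    exact ⟨⟨d, hd⟩⟩
  let e : D ≃o ℤ := orderIsoIntOfLinearSuccPredArch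
  refine ⟨fun i => (e.symm i : ℝ), fun i j hij => e.symm.strictMono hij, ?_⟩
  ext x
  constructor
  · rintro ⟨i, rfl⟩
    exact (e.symm i).2
  · intro hx
    exact ⟨e ⟨x, hx⟩, by simp⟩

theorem exists_indexing {D : Set ℝ} (hfin : ∀ x y, (D ∩ Set.Icc x y).Finite)
    (hup : ∀ x, ∃ d ∈ D, x < d) (hdown : ∀ x, ∃ d ∈ D, d < x) {t₀ : ℝ} (ht₀ : t₀ ∉ D) :
    ∃ τ : ℤ → ℝ, StrictMono τ ∧ Tendsto τ atTop atTop ∧ Tendsto τ atBot atBot ∧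
      (∀ i, τ i ∈ D) ∧ (∀ i, ∀ t ∈ Set.Ioo (τ i) (τ (i + 1)), t ∉ D) ∧
      t₀ ∈ Set.Ioo (τ 0) (τ 1) := by
  obtain ⟨σ, hσ, hr⟩ := exists_strictMono_range_eq hfin hup hdown
  have hσD : ∀ i, σ i ∈ D := fun i => hr ▸ Set.mem_range_self i
  have hDσ : ∀ d ∈ D, ∃ i, σ i = d := fun d hd => by rwa [← hr] at hd
  obtain ⟨k, hk1, hk2⟩ : ∃ k, σ k ≤ t₀ ∧ ∀ i, σ i ≤ t₀ → i ≤ k := by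
    refine Int.exists_greatest_of_bdd (P := fun i => σ i ≤ t₀) ?_ ?_
    · obtain ⟨d, hd, h⟩ := hup t₀
      obtain ⟨j, rfl⟩ := hDσ d hd
      exact ⟨j, fun i hi => (hσ.lt_iff_lt.mp (hi.trans_lt h)).le⟩
    · obtain ⟨d, hd, h⟩ := hdown t₀
      obtain ⟨j, rfl⟩ := hDσ d hd
      exact ⟨j, h.le⟩
  have hmono : StrictMono fun i => σ (i + k) := fun i j hij => hσ (by lia)
  refine ⟨fun i => σ (i + k), hmono, ?_, ?_, fun i => hσD _, ?_, ?_, ?_⟩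
  · refine tendsto_atTop_atTop_of_monotone hmono.monotone fun x => ?_
    obtain ⟨d, hd, h⟩ := hup x
    obtain ⟨j, rfl⟩ := hDσ d hd
    exact ⟨j - k, by simpa using h.le⟩
  · refine tendsto_atBot_atBot_of_monotone hmono.monotone fun x => ?_
    obtain ⟨d, hd, h⟩ := hdown x
    obtain ⟨j, rfl⟩ := hDσ d hd
    exact ⟨j - k, by simpa using h.le⟩
  · intro i t ht hd
    obtain ⟨j, rfl⟩ := hDσ t hd
    have h1 := hσ.lt_iff_lt.mp ht.1
    have h2 := hσ.lt_iff_lt.mp ht.2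
    lia
  · beta_reduce
    rw [zero_add]
    exact hk1.lt_of_ne fun h => ht₀ (h ▸ hσD k)
  · beta_reduce
    by_contra! h
    have := hk2 _ h
    lia

/-- The times at which a geodesic is in the interior of no tile. -/
def crossings {a b : ℝ} (h : a ≠ b) : Set ℝ :=
  {t | ∀ g : SL(2, ℤ), arc h t ∉ g • ModularGroup.fdo}

instance : ContinuousConstSMul SL(2, ℤ) ℍ :=
  ⟨fun g => continuous_const_smul (g : GL (Fin 2) ℝ)⟩

theorem isOpen_tile (g : SL(2, ℤ)) : IsOpen (g • ModularGroup.fdo) :=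
  ModularGroup.isOpen_fdo.smul g

/-- Crossing times are isolated: off the vertices, each point of the geodesic is inside a tile or on
an open side, and a wall function vanishes at most once along the geodesic. -/
theorem eventually_not_mem_crossings {a b : ℝ} (ha : Irrational a) (hb : Irrational b)
    (hab : a ≠ b) (hv : ∀ (g : SL(2, ℤ)) (t : ℝ), arc hab t ∉ g • finiteVertices) (T : ℝ) :
    ∀ᶠ t in 𝓝[≠] T, t ∉ crossings hab := by
  obtain ⟨g, hg⟩ := ModularGroup.exists_smul_mem_fd (arc hab T)
  obtain ⟨κ, hκ⟩ := smul_arc ha hb hab g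
  set hAB := mob_ne ha hb hab g
  have hcont : Continuous fun t : ℝ => arc hAB (t + κ) := (continuous_arc hAB).comp (by fun_prop)
  have key : ∀ t (k : SL(2, ℤ)), k • arc hAB (t + κ) ∈ ModularGroup.fdo → t ∉ crossings hab := by
    intro t k hk ht
    refine ht (k * g)⁻¹ ?_
    rw [Set.mem_smul_set_iff_inv_smul_mem, inv_inv, mul_smul, hκ]
    exact hk
  rcases mem_fd_cases hg with h | ⟨e, h⟩ | h
  · rw [hκ] at h
    have := hcont.continuousAt.eventually (ModularGroup.isOpen_fdo.mem_nhds h)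
    filter_upwards [nhdsWithin_le_nhds this] with t ht
    exact key t 1 (by rwa [one_smul])
  · rw [hκ] at h
    have := hcont.continuousAt.eventually (eventually_of_mem_side h)
    filter_upwards [nhdsWithin_le_nhds this, self_mem_nhdsWithin] with t ht hne
    have hne' : t + κ ≠ T + κ := fun H => hne (add_right_cancel H)
    rcases (wall_arc_ne_zero (irrational_mob hb g) (wall_eq_zero_of_mem_side h) hne').lt_or_gt
      with hw | hw
    · exact key t _ (ht.2 hw)
    · exact key t 1 (by rw [one_smul]; exact ht.1 hw)
  · refine absurd ?_ (hv g⁻¹ T)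
    rwa [Set.mem_smul_set_iff_inv_smul_mem, inv_inv]

theorem finite_crossings {a b : ℝ} (ha : Irrational a) (hb : Irrational b)
    (hab : a ≠ b) (hv : ∀ (g : SL(2, ℤ)) (t : ℝ), arc hab t ∉ g • finiteVertices) (x y : ℝ) :
    (crossings hab ∩ Set.Icc x y).Finite := by
  by_contra hinf
  obtain ⟨T, -, hT⟩ := Set.Infinite.exists_accPt_of_subset_isCompact hinf isCompact_Icc
    Set.inter_subset_right
  rw [accPt_iff_frequently_nhdsNE] at hT
  refine hT ?_
  filter_upwards [eventually_not_mem_crossings ha hb hab hv T] with t ht h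
  exact ht h.1

/-- Open tiles are disjoint up to the sign of the group element, so a connected piece without
crossings stays in one of them. -/
theorem exists_tile_of_disjoint_crossings {a b : ℝ} (hab : a ≠ b) {I : Set ℝ}
    (hI : IsPreconnected I) (hne : I.Nonempty) (hd : ∀ t ∈ I, t ∉ crossings hab) :
    ∃ g : SL(2, ℤ), ∀ t ∈ I, arc hab t ∈ g • ModularGroup.fdo := by
  have hd' : ∀ t ∈ I, ∃ g : SL(2, ℤ), arc hab t ∈ g • ModularGroup.fdo := fun t ht => by
    have := hd t ht
    simpa [crossings] using this
  obtain ⟨t₀, ht₀⟩ := hne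
  obtain ⟨g, hg⟩ := hd' t₀ ht₀
  have hc := continuous_arc hab
  refine ⟨g, fun t ht => ?_⟩
  have := IsPreconnected.subset_left_of_subset_union (s := I)
    (u := arc hab ⁻¹' (g • ModularGroup.fdo))
    (v := arc hab ⁻¹' (⋃ (k : SL(2, ℤ)) (_ : k ≠ g ∧ k ≠ -g), k • ModularGroup.fdo))
    ((isOpen_tile g).preimage hc)
    ((isOpen_biUnion fun k _ => isOpen_tile k).preimage hc) ?_ ?_ ⟨t₀, ht₀, hg⟩ hI
  · exact this ht
  · refine Disjoint.preimage _ (Set.disjoint_left.mpr fun z hz hz' => ?_)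
    simp only [Set.mem_iUnion] at hz'
    obtain ⟨k, ⟨h1, h2⟩, hk⟩ := hz'
    rcases eq_or_eq_neg_of_mem_fdo hk (Set.smul_set_mono ModularGroup.fdo_subset_fd hz) with h | h
    · exact h1 h
    · exact h2 h
  · intro t ht
    obtain ⟨k, hk⟩ := hd' t ht
    by_cases hkg : k ≠ g ∧ k ≠ -g
    · right
      simp only [Set.mem_preimage, Set.mem_iUnion]
      exact ⟨k, hkg, hk⟩
    · left
      rcases (by tauto : k = g ∨ k = -g) with rfl | rfl
      · exact hk
      · have : arc hab t ∈ g • ModularGroup.fdo := by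
          obtain ⟨w, hw, hw'⟩ := hk
          refine ⟨w, hw, ?_⟩
          rw [← hw']
          simp
        exact this

theorem lin_foot_nonneg {a b : ℝ} {hab : a ≠ b} {T : ℝ}
    (h : ∀ t, T < t → arc hab t ∈ ModularGroup.fdo) (e : Letter) : 0 ≤ lin e b (b ^ 2) := by
  by_contra! hneg
  have h1 : Tendsto (fun t : ℝ => Real.exp (2 * t)) atTop atTop :=
    Real.tendsto_exp_atTop.comp (tendsto_id.const_mul_atTop two_pos)
  obtain ⟨t, ht, htT⟩ :=
    ((h1.eventually_gt_atTop (lin e a (a ^ 2) / -lin e b (b ^ 2))).and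
      (eventually_gt_atTop T)).exists
  have h2 := wall_pos_of_mem_fdo (h t htT) e
  have h3 := wall_arc e hab t
  have h4 : 0 < wall e (arc hab t) * (1 + Real.exp (2 * t)) := by positivity
  rw [div_lt_iff₀ (by linarith)] at ht
  linarith

/-- A geodesic staying in one tile would have, after translation, a foot with `|b| ≤ 1/2` and `b² ≥
1`. -/
theorem exists_crossing_gt {a b : ℝ} (ha : Irrational a) (hb : Irrational b)
    (hab : a ≠ b) (T : ℝ) : ∃ d ∈ crossings hab, T < d := by
  by_contra! H
  obtain ⟨g, hg⟩ := exists_tile_of_disjoint_crossings hab (I := Set.Ioi T) isPreconnected_Ioi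
    ⟨T + 1, by simp⟩ fun t ht h => (H t h).not_gt ht
  obtain ⟨κ, hκ⟩ := smul_arc ha hb hab g⁻¹
  have := lin_foot_nonneg (hab := mob_ne ha hb hab g⁻¹) (T := T + κ) fun t ht => by
    have := hg (t - κ) (by simp only [Set.mem_Ioi]; linarith)
    rwa [Set.mem_smul_set_iff_inv_smul_mem, hκ, sub_add_cancel] at this
  have hL := this Letter.L
  have hR := this Letter.R
  have hJ := this Letter.J
  simp only [lin] at hL hR hJ
  nlinarith

theorem arc_reverse {a b : ℝ} (hab : a ≠ b) (t : ℝ) : arc hab t = arc hab.symm (-t) := by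
  have h : Real.exp (2 * -t) = (Real.exp (2 * t))⁻¹ := by rw [← Real.exp_neg]; ring_nf
  apply ext_re_normSq
  · rw [arc_re, arc_re, h]
    field_simp
    ring
  · rw [arc_normSq, arc_normSq, h]
    field_simp
    ring

theorem exists_crossing_lt {a b : ℝ} (ha : Irrational a) (hb : Irrational b)
    (hab : a ≠ b) (T : ℝ) : ∃ d ∈ crossings hab, d < T := by
  obtain ⟨d, hd, h⟩ := exists_crossing_gt hb ha hab.symm (-T)
  refine ⟨-d, fun g => ?_, by linarith⟩
  rw [arc_reverse, neg_neg]
  exact hd g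

theorem exists_mem_side {z : ℍ} {g : SL(2, ℤ)} (hcl : z ∈ closure (g • ModularGroup.fdo))
    (hz : z ∉ g • ModularGroup.fdo) (hv : z ∉ g • finiteVertices) :
    ∃ e, z ∈ g • side e := by
  have hcl' : z ∈ g • ModularGroup.fd := by
    refine closure_minimal (Set.smul_set_mono ModularGroup.fdo_subset_fd) ?_ hcl
    exact ModularGroup.isClosed_fd.smul g
  simp only [Set.mem_smul_set_iff_inv_smul_mem] at *
  rcases mem_fd_cases hcl' with h | h | h
  · exact absurd h hz
  · exact h
  · exact absurd h hv

theorem exists_tiles {a b : ℝ} (ha : Irrational a) (hb : Irrational b)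
    (hab : a ≠ b) (hv : ∀ (g : SL(2, ℤ)) (t : ℝ), arc hab t ∉ g • finiteVertices)
    (hm : ∃ t, arc hab t ∈ ModularGroup.fdo) :
    ∃ (c : ℤ → Letter) (h : ℤ → SL(2, ℤ)) (τ : ℤ → ℝ),
      h 0 = 1 ∧ StrictMono τ ∧ Tendsto τ atTop atTop ∧ Tendsto τ atBot atBot ∧
      (∀ i : ℤ, ∀ t ∈ Set.Ioo (τ i) (τ (i + 1)), arc hab t ∈ h i • ModularGroup.fdo) ∧
      (∀ i : ℤ, arc hab (τ i) ∈ h i • side (c i)) := by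
  obtain ⟨t₀, ht₀⟩ := hm
  have ht₀' : arc hab t₀ ∈ (1 : SL(2, ℤ)) • ModularGroup.fdo := by rwa [one_smul]
  obtain ⟨τ, h1, h2, h3, hD, hI, h0⟩ := exists_indexing (finite_crossings ha hb hab hv)
    (exists_crossing_gt ha hb hab) (exists_crossing_lt ha hb hab) (t₀ := t₀)
    fun H => H 1 ht₀'
  have hex : ∀ i, ∃ g : SL(2, ℤ), (i = 0 → g = 1) ∧
      ∀ t ∈ Set.Ioo (τ i) (τ (i + 1)), arc hab t ∈ g • ModularGroup.fdo := by
    intro i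
    obtain ⟨g, hg⟩ := exists_tile_of_disjoint_crossings hab isPreconnected_Ioo
      (Set.nonempty_Ioo.mpr (h1 (lt_add_one i))) (hI i)
    by_cases hi : i = 0
    · subst hi
      refine ⟨1, fun _ => rfl, ?_⟩
      rw [zero_add] at hg ⊢
      rcases eq_or_eq_neg_of_mem_fdo (hg t₀ h0)
        (Set.smul_set_mono ModularGroup.fdo_subset_fd ht₀') with rfl | rfl
      · exact hg
      · intro t ht
        have := hg t ht
        rw [Set.mem_smul_set_iff_inv_smul_mem] at this ⊢
        simpa using this
    · exact ⟨g, fun H => absurd H hi, hg⟩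
  choose h hh0 hh using hex
  have hside : ∀ i, ∃ e, arc hab (τ i) ∈ h i • side e := by
    intro i
    refine exists_mem_side ?_ (hD i (h i)) (hv _ _)
    have h4 : τ i ∈ closure (Set.Ioo (τ i) (τ (i + 1))) := by
      rw [closure_Ioo (h1 (lt_add_one i)).ne]
      exact Set.left_mem_Icc.mpr (h1 (lt_add_one i)).le
    exact closure_mono (Set.image_subset_iff.mpr (hh i))
      (image_closure_subset_closure_image (continuous_arc hab) ⟨_, h4, rfl⟩)
  choose c hc using hside
  exact ⟨c, h, τ, hh0 0 rfl, h1, h2, h3, hh, hc⟩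

end ModularCutting

/-! ### Finite memory of sofic shifts -/

namespace SymbolicDynamics

/-- If the overlap is at least as long as the longest forbidden word, any occurrence in the glued
sequence already lies in `x` or in `y`. -/
theorem IsShiftOfFiniteType.exists_window {A : Type*} {X : Set (ℤ → A)}
    (hX : IsShiftOfFiniteType X) : ∃ N₀ : ℕ, ∀ N ≥ N₀, ∀ x ∈ X, ∀ y ∈ X, ∀ q : ℤ,
      (∀ i, q ≤ i → i < q + N → x i = y i) → (fun i => if i < q + N then x i else y i) ∈ X := by
  obtain ⟨W, hW, rfl⟩ := hX
  obtain ⟨N₀, hN₀⟩ := (hW.image List.length).bddAbove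
  refine ⟨N₀, fun N hN x hx y hy q hxy w hw hocc => ?_⟩
  have hlen : w.length ≤ N := (hN₀ ⟨w, hw, rfl⟩).trans hN
  obtain ⟨i, hi⟩ := hocc
  rcases lt_or_ge i q with h | h
  · refine hx w hw ⟨i, fun k hk => ?_⟩
    rw [← hi k hk]
    exact (if_pos (by lia)).symm
  · refine hy w hw ⟨i, fun k hk => ?_⟩
    rw [← hi k hk]
    beta_reduce
    split_ifs with hlt
    · exact (hxy _ (by lia) hlt).symm
    · rfl

/-- Among infinitely many points of a sofic shift, there are two such that the left half of one
can be followed by the right half of the other. -/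
theorem IsSofic.exists_splice {B : Type*} {Y : Set (ℤ → B)} (hY : IsSofic Y) (y : ℕ → ℤ → B)
    (hy : ∀ k, y k ∈ Y) (p : ℤ) :
    ∃ j k, j < k ∧ (fun i => if i < p then y j i else y k i) ∈ Y := by
  obtain ⟨A, _, X, hX, m, n, Φ, rfl⟩ := hY
  choose x hxX hxy using hy
  obtain ⟨N₀, hN₀⟩ := hX.exists_window
  -- The window starts at `p - m` and is long enough for gluing and for the block code: blocks read
  -- at positions before `p` end inside it, and blocks read from `p` on start no earlier than it
  -- does. By pigeonhole two preimages agree on it.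
  set N := N₀ + m + n + 1 with hN
  obtain ⟨j, k, hjk, hf⟩ : ∃ j k, j < k ∧ (fun l : Fin N => x j (p - m + (l : ℕ)))
      = fun l : Fin N => x k (p - m + (l : ℕ)) := by
    obtain ⟨j, k, hne, hf⟩ := Finite.exists_ne_map_eq_of_infinite
      fun k => fun l : Fin N => x k (p - m + (l : ℕ))
    rcases hne.lt_or_gt with h | h
    · exact ⟨j, k, h, hf⟩
    · exact ⟨k, j, h, hf.symm⟩
  have hagree : ∀ i, p - m ≤ i → i < p - m + N → x j i = x k i := by
    intro i h1 h2
    have := congrFun hf ⟨(i - (p - m)).toNat, by lia⟩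
    have h3 : p - m + ((i - (p - m)).toNat : ℤ) = i := by lia
    simpa only [h3] using this
  refine ⟨j, k, hjk, _, hN₀ N (by lia) (x j) (hxX j) (x k) (hxX k) (p - m) hagree, ?_⟩
  funext i
  rw [← hxy j, ← hxy k]
  simp only [slidingBlockCode]
  split_ifs with h
  · congr 1
    funext l
    have := l.2
    rw [if_pos (by lia)]
  · congr 1
    funext l
    have := l.2
    split_ifs with hlt
    · exact hagree _ (by lia) hlt
    · rfl

end SymbolicDynamics

/-! ### Generic geodesics in general position -/

namespace ModularCutting
open Filter Topology

theorem exists_agree_of_mem_shift {y : ℤ → Letter} (hy : y ∈ cuttingSequenceShift)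
    (l r : ℤ) : ∃ c ∈ cuttingSequences, ∀ i, l ≤ i → i ≤ r → c i = y i := by
  have hopen : IsOpen ((Set.Icc l r).pi fun i => ({y i} : Set Letter)) :=
    isOpen_set_pi (Set.finite_Icc l r) fun i _ => isOpen_discrete _
  obtain ⟨c, hc, hcS⟩ := mem_closure_iff.mp hy _ hopen fun i _ => rfl
  exact ⟨c, hcS, fun i h1 h2 => hc i ⟨h1, h2⟩⟩

theorem finite_finiteVertices : finiteVertices.Finite := by
  have h : ∀ x y : ℝ, {z : ℍ | z.re = x ∧ z.im = y}.Finite := fun x y =>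
    Set.Subsingleton.finite fun z hz w hw =>
      UpperHalfPlane.ext_re_im (hz.1.trans hw.1.symm) (hz.2.trans hw.2.symm)
  exact ((h _ _).union (h _ _)).union (Set.finite_singleton _)

/-- The head and one further point determine the foot. Hence, for a fixed head, the countably many
translated vertices exclude only countably many feet. -/
theorem foot_eq_of_arc {a b : ℝ} (h : a ≠ b) (t : ℝ) :
    b = (Complex.normSq (arc h t : ℂ) - a * (arc h t).re) / ((arc h t).re - a) := by
  have hc := arc_circle h t
  have hne : (arc h t).re - a ≠ 0 := by
    intro h0
    have h1 : (arc h t).re = a := by linarith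
    have h2 := (arc h t).im_pos
    rw [normSq_eq, h1] at hc
    nlinarith
  rw [eq_div_iff hne, hc]
  ring

/-- A geodesic with a given irrational head avoids all vertices, if its foot is chosen
generically. -/
theorem exists_generic_foot {a u v : ℝ} (huv : u < v) :
    ∃ b ∈ Set.Ioo u v, Irrational b ∧ ∃ h : a ≠ b,
      ∀ (g : SL(2, ℤ)) (t : ℝ), arc h t ∉ g • finiteVertices := by
  have : Countable (Matrix (Fin 2) (Fin 2) ℤ) := inferInstanceAs (Countable (Fin 2 → Fin 2 → ℤ))
  have : Countable SL(2, ℤ) := Subtype.countable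
  let bad : Set ℝ := (Set.range ((↑) : ℚ → ℝ) ∪ {a}) ∪ ⋃ g : SL(2, ℤ),
    (fun z : ℍ => (Complex.normSq (z : ℂ) - a * z.re) / (z.re - a)) '' (g • finiteVertices)
  have hbad : bad.Countable := by
    refine ((Set.countable_range _).union (Set.countable_singleton a)).union
      (Set.countable_iUnion fun g => Set.Countable.image ?_ _)
    exact (finite_finiteVertices.countable.image _)
  obtain ⟨b, hb, hbuv⟩ := (hbad.dense_compl ℝ).exists_mem_open isOpen_Ioo (Set.nonempty_Ioo.mpr huv)
  simp only [bad, Set.mem_compl_iff, Set.mem_union, not_or, Set.mem_iUnion, not_exists] at hb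
  refine ⟨b, hbuv, hb.1.1, fun h => hb.1.2 h.symm, fun g t ht => hb.2 g ⟨_, ht, ?_⟩⟩
  exact (foot_eq_of_arc _ t).symm

theorem isGeneralPosition_of_irrational {a b : ℝ} (ha : Irrational a) (hb : Irrational b)
    (hab : a ≠ b) (hv : ∀ (g : SL(2, ℤ)) (t : ℝ), arc hab t ∉ g • finiteVertices)
    (hm : ∃ t, arc hab t ∈ ModularGroup.fdo) :
    IsGeneralPosition ⟨(a : OnePoint ℝ), (b : OnePoint ℝ),
      fun H => hab (OnePoint.coe_injective H)⟩ where
  meets_interior := hm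
  avoids_vertices := hv
  no_side_segment := by
    rintro g e ⟨t₁, t₂, hlt, h⟩
    obtain ⟨κ, hκ⟩ := smul_arc ha hb hab g⁻¹
    have hside : ∀ t ∈ Set.Icc t₁ t₂,
        wall e (arc (mob_ne ha hb hab g⁻¹) (t + κ)) = 0 := fun t ht => by
      rw [← hκ]
      exact wall_eq_zero_of_mem_side (Set.mem_smul_set_iff_inv_smul_mem.mp (h t ht))
    refine wall_arc_ne_zero (irrational_mob hb g⁻¹) (hside t₁ ⟨le_rfl, hlt.le⟩)
      (t := t₂ + κ) (fun H => ?_) (hside t₂ ⟨hlt.le, le_rfl⟩)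
    linarith
  head_not_cusp := ne_cusp_of_irrational ha
  foot_not_cusp := ne_cusp_of_irrational hb

theorem exists_mem_fdo {a b : ℝ} (hab : a ≠ b) (ha : a < 0) (hb : 0 < b) (h : 1 < -a * b) :
    ∃ t, arc hab t ∈ ModularGroup.fdo := by
  have hpos : 0 < -a / b := div_pos (by linarith) hb
  -- The time at which the geodesic crosses the imaginary axis, where `|z|² = -a * b`.
  refine ⟨Real.log (-a / b) / 2, ?_⟩
  have hs : Real.exp (2 * (Real.log (-a / b) / 2)) = -a / b := by
    rw [mul_div_cancel₀ _ two_ne_zero, Real.exp_log hpos]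
  have hre : (arc hab (Real.log (-a / b) / 2)).re = 0 := by
    rw [arc_re, hs, mul_div_cancel₀ _ hb.ne']
    simp
  refine ⟨?_, by rw [hre]; norm_num⟩
  rw [arc_circle, hre]
  linarith

/-! ### Itineraries and excursions -/

/-- The itinerary of a geodesic: `A i` and `B i` are its endpoints, seen from the `i`-th tile that
it visits, and `c` is its cutting sequence. -/
structure Itinerary (c : ℤ → Letter) (A B : ℤ → ℝ) : Prop where
  irrational_head : ∀ i, Irrational (A i)
  irrational_foot : ∀ i, Irrational (B i)
  entry : ∀ i, Entry (c i) (A i) (B i)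
  head_pred : ∀ i, A (i - 1) = act (c i) (A i)
  foot_pred : ∀ i, B (i - 1) = act (c i) (B i)

theorem exists_itinerary_of_mem {c : ℤ → Letter} (hc : c ∈ cuttingSequences) :
    ∃ A B, Itinerary c A B := by
  obtain ⟨⟨θ₁, θ₂, hne⟩, hγ, h, τ, h0, hτ, -, -, h1, h2⟩ := hc
  obtain ⟨a, ha, rfl⟩ := exists_irrational_of_not_cusp hγ.head_not_cusp
  obtain ⟨b, hb, rfl⟩ := exists_irrational_of_not_cusp hγ.foot_not_cusp
  have hab : a ≠ b := fun H => hne (by rw [H])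
  obtain ⟨A, B, -, -, H⟩ := exists_itinerary ha hb hab h0 hτ h1 h2
  exact ⟨A, B, fun i => (H i).1, fun i => (H i).2.1, fun i => (H i).2.2.1,
    fun i => (H i).2.2.2.1, fun i => (H i).2.2.2.2⟩

theorem exists_itinerary_near {a u v : ℝ} (ha : Irrational a) (huv : u < v) (ha0 : a < 0)
    (hu : 0 < u) (hau : 1 < -a * u) :
    ∃ c ∈ cuttingSequences, ∃ A B, Itinerary c A B ∧ A 0 = a ∧ B 0 ∈ Set.Ioo u v := by
  obtain ⟨b, hbuv, hb, hab, hv⟩ := exists_generic_foot (a := a) huv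
  have hm := exists_mem_fdo hab ha0 (hu.trans hbuv.1) (by nlinarith [hbuv.1])
  obtain ⟨c, h, τ, h0, h1, h2, h3, h4, h5⟩ := exists_tiles ha hb hab hv hm
  refine ⟨c, ⟨_, isGeneralPosition_of_irrational ha hb hab hv hm, h, τ, h0, h1, h2, h3, h4, h5⟩, ?_⟩
  obtain ⟨A, B, hA, hB, H⟩ := exists_itinerary ha hb hab h0 h1 h4 h5
  exact ⟨A, B, ⟨fun i => (H i).1, fun i => (H i).2.1, fun i => (H i).2.2.1,
    fun i => (H i).2.2.2.1, fun i => (H i).2.2.2.2⟩, hA, hB ▸ hbuv⟩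

/-- The label of the side that is paired with the one with a given label. -/
def Letter.inv : Letter → Letter
  | Letter.R => Letter.L
  | Letter.L => Letter.R
  | Letter.J => Letter.J

theorem Letter.inv_inv (e : Letter) : e.inv.inv = e := by cases e <;> rfl

theorem act_inv_act (e : Letter) (x : ℝ) : act e.inv (act e x) = x := by
  cases e <;> simp [act, Letter.inv, neg_div]

theorem act_act_inv (e : Letter) (x : ℝ) : act e (act e.inv x) = x := by
  cases e <;> simp [act, Letter.inv, neg_div]

theorem entry_J_not_R {a b : ℝ} (h : Entry Letter.J a b) (h' : Entry Letter.R a b) : False := by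
  obtain ⟨h1, h2, h3⟩ := h
  obtain ⟨h4, h5, h6⟩ := h'
  have hb : 1 < b := by nlinarith
  have ha : -1 < a := by nlinarith
  rw [abs_of_pos (a := a + b) (by linarith)] at h3
  linarith [neg_abs_le (1 + a * b)]

theorem entry_neg {a b : ℝ} (e : Letter) (h : Entry e a b) : Entry e.inv (-a) (-b) := by
  cases e <;> obtain ⟨h1, h2, h3⟩ := h
  · exact ⟨by linarith, by linarith, by linarith⟩
  · exact ⟨by linarith, by linarith, by linarith⟩
  · refine ⟨by linarith, by linarith, ?_⟩
    rw [neg_mul_neg, ← neg_add, abs_neg]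
    exact h3

/-- A geodesic enters a tile through one side only. This makes it possible to compute letters from
endpoints; the pairs involving `L` and `J` reduce to `R` and `J` by reflection in the imaginary
axis. -/
theorem entry_unique {a b : ℝ} {e e' : Letter} (h : Entry e a b) (h' : Entry e' a b) :
    e = e' := by
  cases e <;> cases e' <;> first | rfl | exfalso
  · linarith [h.1, h'.2.1, h.2.1, h'.1]
  · exact entry_J_not_R (entry_neg _ h') (entry_neg _ h)
  · linarith [h.1, h'.2.1, h.2.1, h'.1]
  · exact entry_J_not_R h' h
  · exact entry_J_not_R (entry_neg _ h) (entry_neg _ h')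
  · exact entry_J_not_R h h'

/-- Entering through a side and leaving, in the opposite direction, through the paired side. -/
theorem entry_reverse {a b : ℝ} (ha : a ≠ 0) (hb : b ≠ 0) {e : Letter} (h : Entry e a b) :
    Entry e.inv (act e b) (act e a) := by
  cases e <;> obtain ⟨h1, h2, h3⟩ := h
  · exact ⟨by simp only [act]; linarith, by simp only [act]; linarith,
      by simp only [act]; linarith⟩
  · exact ⟨by simp only [act]; linarith, by simp only [act]; linarith,
      by simp only [act]; linarith⟩
  · have ha2 : 0 < a ^ 2 := by positivity
    refine ⟨?_, ?_, ?_⟩ <;> simp only [act]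
    · rw [div_pow, neg_one_sq, div_lt_one (by linarith)]; exact h2
    · rw [div_pow, neg_one_sq, one_lt_div ha2]; exact h1
    · have e1 : 1 + -1 / b * (-1 / a) = (1 + a * b) / (a * b) := by field_simp; ring
      have e2 : -1 / b + -1 / a = -((a + b) / (a * b)) := by field_simp; ring
      rw [e1, e2, abs_neg, abs_div, abs_div, mul_div_assoc']
      exact div_lt_div_of_pos_right h3 (abs_pos.mpr (mul_ne_zero ha hb))

/-- The sequence comes, at position `0`, out of an excursion of length `m` to the right. -/
def RunTo (c : ℤ → Letter) (m : ℕ) : Prop :=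
  (∀ j : ℕ, j < m → c (-j) = Letter.R) ∧ c (-m) = Letter.J

namespace Itinerary

variable {c : ℤ → Letter} {A B : ℤ → ℝ}

/-- Reversed from tile `s`, the geodesic enters tile `s - i` from tile `s + 1 - i`, through the side
paired with the one labelled `c (s + 1 - i)`; hence the shift by one and the inverted letter. -/
theorem reverse (h : Itinerary c A B) (s : ℤ) :
    Itinerary (fun i => (c (s + 1 - i)).inv) (fun i => B (s - i)) (fun i => A (s - i)) where
  irrational_head i := h.irrational_foot _
  irrational_foot i := h.irrational_head _
  entry i := by
    have h1 := entry_reverse (h.irrational_head (s + 1 - i)).ne_zero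
      (h.irrational_foot (s + 1 - i)).ne_zero (h.entry (s + 1 - i))
    rw [← h.head_pred, ← h.foot_pred, show s + 1 - i - 1 = s - i by ring] at h1
    exact h1
  head_pred i := by
    have := h.foot_pred (s + 1 - i)
    rw [show s + 1 - i - 1 = s - i by ring] at this
    rw [this, act_inv_act]
    congr 1
    ring
  foot_pred i := by
    have := h.head_pred (s + 1 - i)
    rw [show s + 1 - i - 1 = s - i by ring] at this
    rw [this, act_inv_act]
    congr 1
    ring

theorem eq_of_entry (h : Itinerary c A B) {i : ℤ} {e : Letter} (he : Entry e (A i) (B i)) :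
    c i = e := entry_unique (h.entry i) he

theorem succ_of_entry (h : Itinerary c A B) {i j : ℤ} (hj : j = i + 1) {e : Letter}
    (he : Entry e (B i) (A i)) :
    c j = e.inv ∧ A j = act e (A i) ∧ B j = act e (B i) := by
  subst hj
  have h1 := (h.reverse i).eq_of_entry (i := 0) (e := e) (by simpa using he)
  have h2 : c (i + 1) = e.inv := by
    rw [← h1, Letter.inv_inv]; simp
  refine ⟨h2, ?_, ?_⟩
  · have := h.head_pred (i + 1)
    rw [add_sub_cancel_right, h2] at this
    rw [this, act_act_inv]
  · have := h.foot_pred (i + 1)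
    rw [add_sub_cancel_right, h2] at this
    rw [this, act_act_inv]

theorem sub_of_run (h : Itinerary c A B) {k : ℕ} (hk : ∀ j : ℕ, j < k → c (-j) = Letter.R) :
    A (-k) = A 0 + k ∧ B (-k) = B 0 + k := by
  induction k with
  | zero => simp
  | succ k ih =>
    obtain ⟨h1, h2⟩ := ih fun j hj => hk j (by lia)
    have h3 := h.head_pred (-k)
    have h4 := h.foot_pred (-k)
    rw [hk k (by lia)] at h3 h4
    simp only [act] at h3 h4
    push_cast
    rw [neg_add', h3, h4, h1, h2]
    constructor <;> ring

/-- Each `R` moves the head by `1`, and the entry through `J` at the start of the run requires a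
head in `(-1, 1)`. So the length of the run measures the head up to an error of `1`. -/
theorem abs_head_add_lt (h : Itinerary c A B) {m : ℕ} (hm : RunTo c m) :
    |A 0 + m| < 1 := by
  have h1 := h.entry (-m)
  rw [hm.2, (h.sub_of_run hm.1).1] at h1
  exact (sq_lt_one_iff_abs_lt_one _).mp h1.1

theorem runTo (h : Itinerary c A B) {m : ℕ} (hm : 10 ≤ m) (hA : |A 0 + m| < 1 / 4)
    (hB : 1 / 2 < B 0) (hB' : B 0 < 1) : RunTo c m := by
  have hm' : (10 : ℝ) ≤ m := by exact_mod_cast hm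
  rw [abs_lt] at hA
  have hrun : ∀ j : ℕ, j < m → c (-j) = Letter.R := by
    intro j
    induction j using Nat.strong_induction_on with
    | _ j ih =>
      intro hj
      obtain ⟨h1, h2⟩ := h.sub_of_run (k := j) fun l hl => ih l hl (hl.trans hj)
      have hj' : (j : ℝ) + 1 ≤ m := by exact_mod_cast hj
      have hj0 : (0 : ℝ) ≤ j := Nat.cast_nonneg j
      refine h.eq_of_entry ⟨?_, ?_, ?_⟩
      · rw [h1]; linarith
      · rw [h2]; linarith
      · rw [h1, h2]
        -- The factors of the product in `Entry` exceed `1/4` and `1`; expanding this inequality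
        -- bounds that product below by `m / 4`.
        have hp : 0 ≤ (-(1 / 2) - (A 0 + j) - 1 / 4) * (B 0 + j + 1 / 2 - 1) :=
          mul_nonneg (by linarith) (by linarith)
        linarith
  refine ⟨hrun, ?_⟩
  obtain ⟨h1, h2⟩ := h.sub_of_run hrun
  refine h.eq_of_entry ⟨?_, ?_, ?_⟩
  · rw [h1]; nlinarith
  · rw [h2]; nlinarith
  · rw [h1, h2]
    rw [abs_of_pos (a := A 0 + m + (B 0 + m)) (by linarith)]
    have : |1 + (A 0 + m) * (B 0 + m)| ≤ 1 + 1 / 4 * (B 0 + m) := by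
      rw [abs_le]
      constructor <;> nlinarith
    linarith

end Itinerary

/-! ### The middle block and the lengths of the excursions around it -/

/-- The cutting sequence contains the block `J L J R J` at the positions from `1` to `5`. -/
def Middle (c : ℤ → Letter) : Prop :=
  c 1 = Letter.J ∧ c 2 = Letter.L ∧ c 3 = Letter.J ∧ c 4 = Letter.R ∧ c 5 = Letter.J

/-- The block `J L J R J` is invariant under reversal with inversion, which exchanges the roles of
`x` and `y`. The value of `B 0` is the one whose image after the block is `-y`. -/
theorem Itinerary.middle {c : ℤ → Letter} {A B : ℤ → ℝ} (h : Itinerary c A B) {m x y : ℝ}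
    (hm : 10 ≤ m) (hx : |x - m| < 1 / 4) (hy : |y - m| < 1 / 4) (hA : A 0 = -x)
    (hB : B 0 = (y + 1) / (2 * y + 1)) :
    Middle c ∧ A 5 = (x + 1) / (2 * x + 1) ∧ B 5 = -y := by
  rw [abs_lt] at hx hy
  have hx0 : 0 < x := by linarith
  have hy0 : 0 < y := by linarith
  obtain ⟨c1, hA1, hB1⟩ := h.succ_of_entry (i := 0) (j := 1) (by norm_num) (e := Letter.J) <| by
    rw [hA, hB]
    refine ⟨?_, by nlinarith, ?_⟩
    · rw [div_pow, div_lt_one (by positivity)]; nlinarith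
    · have e1 : 1 + (y + 1) / (2 * y + 1) * -x = -((x * (y + 1) - (2 * y + 1)) / (2 * y + 1)) := by
        field_simp; ring
      have e2 : (y + 1) / (2 * y + 1) + -x = -((x * (2 * y + 1) - (y + 1)) / (2 * y + 1)) := by
        field_simp; ring
      have p1 : 0 < x * (y + 1) - (2 * y + 1) := by nlinarith
      have p2 : 0 < x * (2 * y + 1) - (y + 1) := by nlinarith
      rw [e1, e2, abs_neg, abs_neg, abs_of_pos (by positivity), abs_of_pos (by positivity),
        mul_div_assoc']
      exact div_lt_div_of_pos_right (by nlinarith) (by positivity)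
  replace hA1 : A 1 = 1 / x := by rw [hA1, hA]; simp only [act]; field_simp
  replace hB1 : B 1 = -((2 * y + 1) / (y + 1)) := by rw [hB1, hB]; simp only [act]; field_simp
  obtain ⟨c2, hA2, hB2⟩ := h.succ_of_entry (i := 1) (j := 2) (by norm_num) (e := Letter.R) <| by
    rw [hA1, hB1]
    refine ⟨?_, ?_, ?_⟩
    · rw [neg_lt_neg_iff, lt_div_iff₀ (by positivity)]; linarith
    · have : 0 < 1 / x := by positivity
      linarith
    · have e1 : (-(1 / 2) - -((2 * y + 1) / (y + 1))) * (1 / x + 1 / 2)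
          = ((3 * y + 1) * (x + 2)) / (4 * x * (y + 1)) := by field_simp; ring
      rw [e1, lt_div_iff₀ (by positivity)]
      nlinarith
  replace hA2 : A 2 = (x + 1) / x := by rw [hA2, hA1]; simp only [act]; field_simp; ring
  replace hB2 : B 2 = -(y / (y + 1)) := by rw [hB2, hB1]; simp only [act]; field_simp; ring
  obtain ⟨c3, hA3, hB3⟩ := h.succ_of_entry (i := 2) (j := 3) (by norm_num) (e := Letter.J) <| by
    rw [hA2, hB2]
    refine ⟨?_, ?_, ?_⟩
    · rw [neg_sq, div_pow, div_lt_one (by positivity)]; nlinarith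
    · rw [div_pow, one_lt_div (by positivity)]; nlinarith
    · have e1 : 1 + -(y / (y + 1)) * ((x + 1) / x) = (x - y) / (x * (y + 1)) := by
        field_simp; ring
      have e2 : -(y / (y + 1)) + (x + 1) / x = (x + y + 1) / (x * (y + 1)) := by
        field_simp; ring
      rw [e1, e2, abs_div, abs_div, mul_div_assoc']
      refine div_lt_div_of_pos_right ?_ (by positivity)
      rw [abs_of_pos (a := x + y + 1) (by positivity)]
      -- The critical crossing: it needs `2 * |x - y| < x + y + 1`, hence `x` and `y` of comparable
      -- size.
      have : |x - y| < 1 / 2 := abs_lt.mpr ⟨by linarith, by linarith⟩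
      linarith
  replace hA3 : A 3 = -(x / (x + 1)) := by rw [hA3, hA2]; simp only [act]; field_simp
  replace hB3 : B 3 = (y + 1) / y := by rw [hB3, hB2]; simp only [act]; field_simp
  obtain ⟨c4, hA4, hB4⟩ := h.succ_of_entry (i := 3) (j := 4) (by norm_num) (e := Letter.L) <| by
    rw [hA3, hB3]
    refine ⟨?_, ?_, ?_⟩
    · have : 0 < x / (x + 1) := by positivity
      linarith
    · rw [lt_div_iff₀ (by positivity)]; linarith
    · have e1 : ((y + 1) / y - 1 / 2) * (1 / 2 - -(x / (x + 1)))
          = ((y + 2) * (3 * x + 1)) / (4 * y * (x + 1)) := by field_simp; ring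
      rw [e1, lt_div_iff₀ (by positivity)]
      nlinarith
  replace hA4 : A 4 = -((2 * x + 1) / (x + 1)) := by
    rw [hA4, hA3]; simp only [act]; field_simp; ring
  replace hB4 : B 4 = 1 / y := by rw [hB4, hB3]; simp only [act]; field_simp; ring
  obtain ⟨c5, hA5, hB5⟩ := h.succ_of_entry (i := 4) (j := 5) (by norm_num) (e := Letter.J) <| by
    rw [hA4, hB4]
    refine ⟨?_, ?_, ?_⟩
    · rw [div_pow, div_lt_one (by positivity)]; nlinarith
    · rw [neg_sq, div_pow, one_lt_div (by positivity)]; nlinarith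
    · have e1 : 1 + 1 / y * -((2 * x + 1) / (x + 1))
          = (y * (x + 1) - (2 * x + 1)) / (y * (x + 1)) := by field_simp; ring
      have e2 : 1 / y + -((2 * x + 1) / (x + 1))
          = -((y * (2 * x + 1) - (x + 1)) / (y * (x + 1))) := by field_simp; ring
      have p1 : 0 < y * (x + 1) - (2 * x + 1) := by nlinarith
      have p2 : 0 < y * (2 * x + 1) - (x + 1) := by nlinarith
      rw [e1, e2, abs_neg, abs_of_pos (by positivity), abs_of_pos (by positivity), mul_div_assoc']
      exact div_lt_div_of_pos_right (by nlinarith) (by positivity)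
  replace hA5 : A 5 = (x + 1) / (2 * x + 1) := by rw [hA5, hA4]; simp only [act]; field_simp
  replace hB5 : B 5 = -y := by rw [hB5, hB4]; simp only [act]; field_simp
  exact ⟨⟨c1, c2, c3, c4, c5⟩, hA5, hB5⟩

/-- The letters from the sixth on, read backwards and inverted. -/
def future (c : ℤ → Letter) : ℤ → Letter := fun i => (c (5 + 1 - i)).inv

theorem half_lt_and_lt_one {x : ℝ} (hx : 0 < x) :
    1 / 2 < (x + 1) / (2 * x + 1) ∧ (x + 1) / (2 * x + 1) < 1 := by
  rw [lt_div_iff₀ (by positivity), div_lt_one (by positivity)]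
  constructor <;> linarith

/-- Excursions of equal lengths before and after the middle block do occur. -/
theorem exists_mem_cuttingSequences {m : ℕ} (hm : 10 ≤ m) :
    ∃ c ∈ cuttingSequences, RunTo c m ∧ Middle c ∧ RunTo (future c) m := by
  have hm' : (10 : ℝ) ≤ m := by exact_mod_cast hm
  obtain ⟨a, ha, ha1, ha2⟩ := exists_irrational_btwn
    (show (-(m : ℝ) - 1 / 4) < -m + 1 / 4 by linarith)
  -- The interval for `B 0` is the image of `(m - 1/4, m + 1/4)` under the decreasing map `y ↦ (y +
  -- 1) / (2 * y + 1)`; `y` below is recovered by the inverse map.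
  have huv : ((m : ℝ) + 5 / 4) / (2 * m + 3 / 2) < (m + 3 / 4) / (2 * m + 1 / 2) := by
    rw [div_lt_div_iff₀ (by positivity) (by positivity)]
    nlinarith
  have hu : 1 / 2 < ((m : ℝ) + 5 / 4) / (2 * m + 3 / 2) := by
    rw [lt_div_iff₀ (by positivity)]; linarith
  obtain ⟨c, hc, A, B, hI, hA, hB1, hB2⟩ := exists_itinerary_near ha huv (by linarith)
    (by linarith) (by nlinarith)
  have hb : 0 < 2 * B 0 - 1 := by linarith
  rw [div_lt_iff₀ (by positivity)] at hB1
  rw [lt_div_iff₀ (by positivity)] at hB2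
  set y := (1 - B 0) / (2 * B 0 - 1) with hy
  have hy1 : |y - m| < 1 / 4 := by
    rw [abs_lt]
    constructor
    · rw [neg_lt_sub_iff_lt_add, add_comm, ← sub_lt_iff_lt_add, hy, lt_div_iff₀ hb]; linarith
    · rw [sub_lt_iff_lt_add, hy, div_lt_iff₀ hb]; linarith
  have hx1 : |-a - m| < 1 / 4 := abs_lt.mpr ⟨by linarith, by linarith⟩
  have hy0 : 0 < y := by linarith [(abs_lt.mp hy1).1]
  have hBy : B 0 = (y + 1) / (2 * y + 1) := by
    have h1 : y * (2 * B 0 - 1) = 1 - B 0 := div_mul_cancel₀ _ hb.ne'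
    rw [eq_div_iff (by positivity)]
    linarith
  obtain ⟨hmid, hA5, hB5⟩ := hI.middle hm' hx1 hy1 (by rw [hA]; ring) hBy
  refine ⟨c, hc, ?_, hmid, ?_⟩
  · refine hI.runTo hm ?_ ?_ ?_
    · rw [hA, abs_lt]; constructor <;> linarith
    · rw [hBy]; exact (half_lt_and_lt_one hy0).1
    · rw [hBy]; exact (half_lt_and_lt_one hy0).2
  · refine (hI.reverse 5).runTo hm ?_ ?_ ?_
    · rw [sub_zero, hB5, ← abs_neg, neg_add, neg_neg, ← sub_eq_add_neg]
      exact hy1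
    · rw [sub_zero, hA5]; exact (half_lt_and_lt_one (by linarith)).1
    · rw [sub_zero, hA5]; exact (half_lt_and_lt_one (by linarith)).2

/-- The excursion after the middle block cannot be much longer than the one before it. -/
theorem lt_of_mem_cuttingSequences {c : ℤ → Letter} (hc : c ∈ cuttingSequences) {m n : ℕ}
    (hm : 2 ≤ m) (hn : 2 ≤ n) (h1 : RunTo c m) (h2 : Middle c) (h3 : RunTo (future c) n) :
    n < 3 * m + 5 := by
  obtain ⟨A, B, hI⟩ := exists_itinerary_of_mem hc
  have hm' : (2 : ℝ) ≤ m := by exact_mod_cast hm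
  have hn' : (2 : ℝ) ≤ n := by exact_mod_cast hn
  have hA := hI.abs_head_add_lt h1
  have hB := (hI.reverse 5).abs_head_add_lt h3
  beta_reduce at hB
  rw [sub_zero] at hB
  rw [abs_lt] at hA hB
  obtain ⟨x, hx⟩ : ∃ x, A 0 = -x := ⟨-A 0, by ring⟩
  obtain ⟨y, hy⟩ : ∃ y, B 5 = -y := ⟨-B 5, by ring⟩
  rw [hx] at hA
  rw [hy] at hB
  have hx0 : 0 < x := by linarith
  have hy0 : 0 < y := by linarith
  obtain ⟨c1, c2, c3, c4, c5⟩ := h2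
  have succ : ∀ i, A (i + 1) = act (c (i + 1)).inv (A i) := fun i => by
    have := hI.head_pred (i + 1)
    rw [add_sub_cancel_right] at this
    rw [this, act_inv_act]
  have hA3 : A 3 = -(x / (x + 1)) := by
    have a1 : A 1 = act (c 1).inv (A 0) := succ 0
    have a2 : A 2 = act (c 2).inv (A 1) := succ 1
    have a3 : A 3 = act (c 3).inv (A 2) := succ 2
    rw [a3, a2, a1, c1, c2, c3, hx]
    simp only [act, Letter.inv]
    have : -1 / -x + 1 = (x + 1) / x := by field_simp; ring
    rw [this]
    field_simp
  have hB3 : B 3 = (y + 1) / y := by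
    have b4 : B 4 = act (c 5) (B 5) := hI.foot_pred 5
    have b3 : B 3 = act (c 4) (B 4) := hI.foot_pred 4
    rw [b3, b4, c4, c5, hy]
    simp only [act]
    field_simp
    ring
  -- The entry through the central `J` gives `2 * |y - x| < x + y + 1`, so `y < 3 * x + 1`; then `x
  -- < m + 1` and `n - 1 < y` finish.
  have hE := hI.entry 3
  rw [c3, hA3, hB3] at hE
  have hE := hE.2.2
  have e1 : 1 + -(x / (x + 1)) * ((y + 1) / y) = (y - x) / ((x + 1) * y) := by field_simp; ring
  have e2 : -(x / (x + 1)) + (y + 1) / y = (x + y + 1) / ((x + 1) * y) := by field_simp; ring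
  rw [e1, e2, abs_div, abs_div, mul_div_assoc', div_lt_div_iff_of_pos_right (by positivity),
    abs_of_pos (a := x + y + 1) (by positivity)] at hE
  have : (n : ℝ) < 3 * m + 5 := by linarith [le_abs_self (y - x)]
  exact_mod_cast this

end ModularCutting

/-! ### The contradiction -/

open ModularCutting in
theorem theorem7p3 :
    ¬ SymbolicDynamics.IsSofic ModularCutting.cuttingSequenceShift := by
  intro hs
  have h10 : ∀ k : ℕ, 10 ≤ 10 * 4 ^ k := fun k => by
    have := Nat.one_le_pow k 4 (by norm_num)
    lia
  choose y hy hpast hmid hfut using fun k : ℕ => exists_mem_cuttingSequences (h10 k)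
  -- Position `1` is where the middle block begins, so the splice joins the excursion of length `m`
  -- to the middle and future of a sequence whose excursions have length `n ≥ 4 * m`. As `m ≥ 10`,
  -- this exceeds `3 * m + 5`.
  obtain ⟨j, k, hjk, hmem⟩ := hs.exists_splice y (fun k => subset_closure (hy k)) 1
  set m := 10 * 4 ^ j with hm
  set n := 10 * 4 ^ k with hn
  have hlen : 4 * m ≤ n := by
    have := Nat.pow_le_pow_right (n := 4) (by norm_num) (Nat.succ_le_of_lt hjk)
    rw [Nat.succ_eq_add_one, pow_succ] at this
    lia
  have hm10 : 10 ≤ m := h10 j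
  -- The spliced sequence is only in the closure, but the window from `-m` to `6 + n` holds the
  -- whole block with both terminal `J`s, so a true cutting sequence contains it.
  obtain ⟨c, hc, hcy⟩ := exists_agree_of_mem_shift hmem (-m) (6 + n)
  have hpre : ∀ i : ℤ, -m ≤ i → i < 1 → c i = y j i := fun i h1 h2 => by
    rw [hcy i h1 (by lia), if_pos h2]
  have hpost : ∀ i : ℤ, 1 ≤ i → i ≤ 6 + n → c i = y k i := fun i h1 h2 => by
    rw [hcy i (by lia) h2, if_neg (by lia)]
  have hlt := lt_of_mem_cuttingSequences hc (m := m) (n := n) (by lia) (by lia)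
    ⟨fun l hl => by rw [hpre _ (by lia) (by lia)]; exact (hpast j).1 l hl,
      by rw [hpre _ le_rfl (by lia)]; exact (hpast j).2⟩
    (by
      obtain ⟨h1, h2, h3, h4, h5⟩ := hmid k
      refine ⟨?_, ?_, ?_, ?_, ?_⟩ <;> rw [hpost _ (by lia) (by lia)] <;> assumption)
    ⟨fun l hl => by
        rw [future, hpost _ (by lia) (by lia)]; exact (hfut k).1 l hl,
      by rw [future, hpost _ (by lia) (by lia)]; exact (hfut k).2⟩
  lia
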